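/- Let $\mathcal{E}$ be a locally cartesian closed category and let $I$ be an object of $\mathcal{E}$. *Notation.* A polynomial $F : I \nrightarrow J$ is a diagram $I \xleftarrow{s} B \xrightarrow{f} A \xrightarrow{t} J$, and its extension is the functor $P_F = \Sigma_t \Pi_f \Delta_s : \mathcal{E}/I \to \mathcal{E}/J$. $\mathfrak{Poly}^{\mathrm{cart}}_{\mathcal{E}}(I,J)$ is the 2-category whose 0-cells are the polynomials from $I$ to $J$, whose 1-cells are the cartesian morphisms of polynomials, represented by pullback squares $(\varphi_0 : A \to C,\ \varphi_1 : B \to D)$ from $f$ to $g$ that commute with the maps to $I$ and $J$, and whose 2-cells are the adjustments (morphisms $D_\varphi \to D_\psi$ over $B$). A polynomial pseudomonad $\mathbb{P} = (p,\eta,\mu,\alpha,\lambda,\rho)$ on $I$ is a polynomial $p : I \nrightarrow I$ with cartesian morphisms $\eta : i_I \Rightarrow p$ and $\mu : p \cdot p \Rightarrow p$ and invertible adjustments $\alpha : \mu \circ (p\cdot\mu) \cong \mu\circ(\mu\cdot p)$, $\lambda : \mu\circ(p\cdot\eta) \cong \mathrm{id}_p$, $\rho : \mu\circ(\eta\cdot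 p)\cong\mathrm{id}_p$ satisfying the coherence axioms of a pseudomonad; it is a polynomial 2-monad if $\alpha,\lambda,\rho$ are identities. A pseudomonad on a 2-category $\mathcal{K}$ consists of a 2-functor $P : \mathcal{K}\to\mathcal{K}$, pseudonatural transformations $h : \mathrm{id} \Rightarrow P$ and $m : PP \Rightarrow P$ and invertible modifications $m\circ Pm \cong m \circ mP$, $m \circ Ph \cong \mathrm{id}$, $m \circ hP \cong \mathrm{id}$ satisfying the two coherence axioms; it is a 2-monad if the three modifications are identities and $h$, $m$ are 2-natural. The cartesian morphisms $\eta$ and $\mu$ induce natural transformations $P_\eta : \mathrm{id} \Rightarrow P_p$ and $P_\mu : P_p P_p \Rightarrow P_p$. *The action of $P_p$ on polynomials.* For $F = (I \xleftarrow{s} B \xrightarrow{f} A \xrightarrow{t} I)$, regard $A$ and $B$ as objects over $I$ via $t$ and $t f$. A fibrewise application of $P_p$ to $F$ is a polynomial $F^+ = (I \xleftarrow{s^+} B^+ \xrightarrow{f^+} P_p(A) \to I)$ with a map $\pi : B^+ \to P_p(B)$ over $I$ such that $$\begin{array}{ccc} B^+ & \xrightarrow{\ \pi\ } & P_p(B)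 \\ {\scriptstyle\langle s^+,f^+\rangle}\downarrow & & \downarrow{\scriptstyle P_p(\langle s,f\rangle)} \\ I \times P_p(A) & \xrightarrow{\ \mathrm{st}\ } & P_p(I \times A)\end{array}$$ is a pullback square, where $\mathrm{st}$ is the strength of $P_p$; that is, $f^+$ is the family $P_p(f_i) : P_p(B_i) \to P_p(A)$, $i \in I$. If $I$ is terminal, then $P_p(f) : P_p(B) \to P_p(A)$ is such an $F^+$, with $\pi = \mathrm{id}$. **Theorem.** Let $\mathbb{P} = (p,\eta,\mu,\alpha,\lambda,\rho)$ be a polynomial pseudomonad on $I$, and choose for every polynomial $F : I \nrightarrow I$ a fibrewise application $F^+$ of $P_p$ to $F$. Then there is a pseudomonad $\mathbb{P}^+ = (P,h,m,\dots)$ on the 2-category $\mathfrak{Poly}^{\mathrm{cart}}_{\mathcal{E}}(I,I)$, which is a 2-monad if $\mathbb{P}$ is a polynomial 2-monad, such that * $P(F) = F^+$ for every polynomial $F : I \nrightarrow I$; * for every pullback square $\varphi : F \Rightarrow G$, $P(\varphi)$ is the result of applying $P_p$ to $\varphi$: $P(\varphi)_0 = P_p(\varphi_0)$ and $\pi_G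 \circ P(\varphi)_1 = P_p(\varphi_1)\circ\pi_F$; * the unit $h_F : F \Rightarrow P(F)$ is given by $P_\eta$: $(h_F)_0 = (P_\eta)_A$ and $\pi_F\circ(h_F)_1 = (P_\eta)_B$; * the multiplication $m_F : P(P(F)) \Rightarrow P(F)$ is given by $P_\mu$: $(m_F)_0 = (P_\mu)_A$ and $\pi_F \circ (m_F)_1 = (P_\mu)_B \circ P_p(\pi_F)\circ\pi_{P(F)}$. In particular, if $I$ is terminal, there is such a $\mathbb{P}^+$ with $P(f) = P_p(f)$ for every polynomial $1 \leftarrow B \xrightarrow{f} A \to 1$, so that $P(\varphi)$ is the pullback square $(P_p(\varphi_0),P_p(\varphi_1))$ and $h_f$, $m_f$ are the naturality squares of $P_\eta$ and $P_\mu$ at $f$. -/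

import Mathlib

universe v u

namespace LCC

open CategoryTheory ChosenPullbacksAlong ExponentiableMorphism

/-- A polynomial `I ←s− B −f→ A −t→ J`. -/
structure Poly {E : Type u} [Category.{v} E] (I J : E) where
  B : E
  A : E
  s : B ⟶ I
  f : B ⟶ A
  t : A ⟶ J

section

variable {E : Type u} [Category.{v} E]

namespace Poly

/-- The identity polynomial on `I`. -/
abbrev ident (I : E) : Poly I I := ⟨I, I, 𝟙 I, 𝟙 I, 𝟙 I⟩

/-- `A` as an object over the target of the polynomial. -/
abbrev cod {I J : E} (F : Poly I J) : Over J := Over.mk F.t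

/-- `B` as an object over the target of the polynomial. -/
abbrev dom {I J : E} (F : Poly I J) : Over J := Over.mk (F.f ≫ F.t)

end Poly

/-! ### Morphisms of polynomials and adjustments -/

/-- A morphism of polynomials `F ⟶ G`: maps `φ₀ : A ⟶ C`, `φ₁ : D_φ ⟶ D` and `φ₂ : D_φ ⟶ B`,
where `D_φ` is a pullback of `φ₀` and `g`. -/
structure PolyHom {I J : E} (F G : Poly I J) where
  D : E
  φ₀ : F.A ⟶ G.A
  φ₁ : D ⟶ G.B
  φ₂ : D ⟶ F.B
  isPullback : IsPullback φ₁ (φ₂ ≫ F.f) G.f φ₀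
  w_s : φ₂ ≫ F.s = φ₁ ≫ G.s
  w_t : φ₀ ≫ G.t = F.t

/-- A morphism of polynomials is cartesian if `φ₂` is invertible. -/
def PolyHom.IsCartesian {I J : E} {F G : Poly I J} (φ : PolyHom F G) : Prop := IsIso φ.φ₂

/-- An adjustment `φ ⟶ ψ`: a morphism `D_φ ⟶ D_ψ` over `B`. -/
@[ext]
structure Adjustment {I J : E} {F G : Poly I J} (φ ψ : PolyHom F G) where
  hom : φ.D ⟶ ψ.D
  w : hom ≫ ψ.φ₂ = φ.φ₂

/-- A cartesian morphism of polynomials, in its representation as a pullback square. -/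
@[ext]
structure CartHom {I J : E} (F G : Poly I J) where
  φ₀ : F.A ⟶ G.A
  φ₁ : F.B ⟶ G.B
  isPullback : IsPullback φ₁ F.f G.f φ₀
  w_s : φ₁ ≫ G.s = F.s
  w_t : φ₀ ≫ G.t = F.t

namespace CartHom

variable {I J : E} {F G H : Poly I J}

/-- The morphism of polynomials `(φ₀, φ₁, id_B)` given by a pullback square. -/
def toPolyHom (φ : CartHom F G) : PolyHom F G where
  D := F.B
  φ₀ := φ.φ₀
  φ₁ := φ.φ₁
  φ₂ := 𝟙 _
  isPullback := by simpa using φ.isPullback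
  w_s := by simp [φ.w_s]
  w_t := φ.w_t

lemma toPolyHom_isCartesian (φ : CartHom F G) : φ.toPolyHom.IsCartesian :=
  inferInstanceAs (IsIso (𝟙 F.B))

/-- Every cartesian morphism of polynomials is represented by a pullback square. -/
noncomputable def ofPolyHom (φ : PolyHom F G) (h : φ.IsCartesian) : CartHom F G :=
  have : IsIso φ.φ₂ := h
  { φ₀ := φ.φ₀
    φ₁ := inv φ.φ₂ ≫ φ.φ₁
    isPullback := IsPullback.of_iso φ.isPullback (asIso φ.φ₂) (Iso.refl _) (Iso.refl _)
      (Iso.refl _) (by simp) (by simp) (by simp) (by simp)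
    w_s := by simp [← φ.w_s]
    w_t := φ.w_t }

/-- The identity pullback square. -/
def id (F : Poly I J) : CartHom F F where
  φ₀ := 𝟙 _
  φ₁ := 𝟙 _
  isPullback := IsPullback.of_id_fst
  w_s := by simp
  w_t := by simp

/-- Horizontal pasting of pullback squares. -/
def comp (φ : CartHom F G) (ψ : CartHom G H) : CartHom F H where
  φ₀ := φ.φ₀ ≫ ψ.φ₀
  φ₁ := φ.φ₁ ≫ ψ.φ₁
  isPullback := φ.isPullback.paste_horiz ψ.isPullback
  w_s := by simp [ψ.w_s, φ.w_s]
  w_t := by simp [ψ.w_t, φ.w_t]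

/-- The action on `A`, over the target of the polynomials. -/
abbrev cod (φ : CartHom F G) : F.cod ⟶ G.cod := Over.homMk φ.φ₀ φ.w_t

/-- The action on `B`, over the target of the polynomials. -/
abbrev dom (φ : CartHom F G) : F.dom ⟶ G.dom :=
  Over.homMk φ.φ₁ (by simp [φ.isPullback.w_assoc, φ.w_t])

end CartHom

/-! ### The hom 2-category of polynomials, cartesian morphisms and adjustments -/

section HomTwoCategory

variable {I J : E}

@[simps]
instance : CategoryStruct (Poly I J) where
  Hom := CartHom
  id := CartHom.id
  comp := CartHom.comp

@[ext]
lemma cartHom_ext {F G : Poly I J} {φ ψ : F ⟶ G} (h₀ : φ.φ₀ = ψ.φ₀) (h₁ : φ.φ₁ = ψ.φ₁) : φ = ψ :=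
  CartHom.ext h₀ h₁

/-- Adjustments between cartesian morphisms, composed as morphisms of `E`. -/
instance homCategory (F G : Poly I J) : Category (F ⟶ G) where
  Hom φ ψ := Adjustment φ.toPolyHom ψ.toPolyHom
  id φ := ⟨𝟙 _, by simp⟩
  comp α β := ⟨α.hom ≫ β.hom, by simp [α.w, β.w]⟩
  id_comp α := Adjustment.ext (Category.id_comp α.hom)
  comp_id α := Adjustment.ext (Category.comp_id α.hom)
  assoc α β γ := Adjustment.ext (Category.assoc α.hom β.hom γ.hom)

/-- The adjustment between two parallel cartesian morphisms. -/
def adj {F G : Poly I J} (φ ψ : F ⟶ G) : φ ⟶ ψ :=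
  (⟨𝟙 F.B, Category.id_comp _⟩ : Adjustment φ.toPolyHom ψ.toPolyHom)

/-- Parallel adjustments between cartesian morphisms are equal. -/
instance adj_subsingleton {F G : Poly I J} (φ ψ : F ⟶ G) : Subsingleton (φ ⟶ ψ) where
  allEq α β := Adjustment.ext (by
    have h₁ : α.hom ≫ 𝟙 F.B = 𝟙 F.B := α.w
    have h₂ : β.hom ≫ 𝟙 F.B = 𝟙 F.B := β.w
    exact ((Category.comp_id _).symm.trans h₁).trans ((Category.comp_id _).symm.trans h₂).symm)

/-- Parallel cartesian morphisms are isomorphic through an adjustment. -/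
def adjIso {F G : Poly I J} (φ ψ : F ⟶ G) : φ ≅ ψ where
  hom := adj φ ψ
  inv := adj ψ φ
  hom_inv_id := Subsingleton.elim _ _
  inv_hom_id := Subsingleton.elim _ _

/-- The 2-category whose 0-cells are the polynomials from `I` to `J`, whose 1-cells are the
cartesian morphisms and whose 2-cells are the adjustments. (There is exactly one adjustment between
parallel cartesian morphisms, so whiskering of adjustments and all equations are forced.) -/
instance homBicategory : Bicategory (Poly I J) where
  homCategory := homCategory
  whiskerLeft φ ψ χ _ := adj (φ ≫ ψ) (φ ≫ χ)
  whiskerRight {_ _ _ φ ψ} _ χ := adj (φ ≫ χ) (ψ ≫ χ)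
  associator φ ψ χ := adjIso ((φ ≫ ψ) ≫ χ) (φ ≫ ψ ≫ χ)
  leftUnitor φ := adjIso (𝟙 _ ≫ φ) φ
  rightUnitor φ := adjIso (φ ≫ 𝟙 _) φ
  whiskerLeft_id _ _ := Subsingleton.elim _ _
  whiskerLeft_comp _ _ _ _ _ _ := Subsingleton.elim _ _
  id_whiskerLeft _ := Subsingleton.elim _ _
  comp_whiskerLeft _ _ _ _ _ := Subsingleton.elim _ _
  id_whiskerRight _ _ := Subsingleton.elim _ _
  comp_whiskerRight _ _ _ := Subsingleton.elim _ _
  whiskerRight_id _ := Subsingleton.elim _ _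
  whiskerRight_comp _ _ _ := Subsingleton.elim _ _
  whisker_assoc _ _ _ _ _ := Subsingleton.elim _ _
  whisker_exchange _ _ := Subsingleton.elim _ _
  pentagon _ _ _ _ := Subsingleton.elim _ _
  triangle _ _ := Subsingleton.elim _ _

instance homBicategory_strict : Bicategory.Strict (Poly I J) where
  id_comp _ := CartHom.ext (Category.id_comp _) (Category.id_comp _)
  comp_id _ := CartHom.ext (Category.comp_id _) (Category.comp_id _)
  assoc _ _ _ := CartHom.ext (Category.assoc _ _ _) (Category.assoc _ _ _)
  leftUnitor_eqToIso _ := Iso.ext (Subsingleton.elim _ _)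
  rightUnitor_eqToIso _ := Iso.ext (Subsingleton.elim _ _)
  associator_eqToIso _ _ _ := Iso.ext (Subsingleton.elim _ _)

end HomTwoCategory

end

/-! ### Extensions of polynomials

A locally cartesian closed category is a category with chosen finite products, a chosen pullback
functor `Δ_f = pullback f` for every morphism `f`, and a right adjoint `Π_f = pushforward f` of
every `Δ_f`; the left adjoint of `Δ_f` is `Σ_f = Over.map f`. -/

noncomputable section

variable {E : Type u} [Category.{v} E] [ChosenPullbacks E]

/-- The map `Z ×_A B ⟶ W ×_A B` induced by `g : Z ⟶ W` over `A`. -/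
def reindex {B A Z W : E} (f : B ⟶ A) {b : W ⟶ A} (g : Z ⟶ W) (a : Z ⟶ A) (h : g ≫ b = a) :
    pullbackObj a f ⟶ pullbackObj b f :=
  lift (fst a f ≫ g) (snd a f) (by rw [Category.assoc, h, condition])

@[simp]
lemma reindex_fst {B A Z W : E} (f : B ⟶ A) {b : W ⟶ A} (g : Z ⟶ W) (a : Z ⟶ A) (h : g ≫ b = a) :
    reindex f g a h ≫ fst b f = fst a f ≫ g := lift_fst _ _ _

@[simp]
lemma reindex_snd {B A Z W : E} (f : B ⟶ A) {b : W ⟶ A} (g : Z ⟶ W) (a : Z ⟶ A) (h : g ≫ b = a) :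
    reindex f g a h ≫ snd b f = snd a f := lift_snd _ _ _

@[simp]
lemma reindex_fst_assoc {B A Z W V : E} (f : B ⟶ A) {b : W ⟶ A} (g : Z ⟶ W) (a : Z ⟶ A)
    (h : g ≫ b = a) (k : W ⟶ V) : reindex f g a h ≫ fst b f ≫ k = fst a f ≫ g ≫ k := by
  rw [reassoc_of% (reindex_fst f g a h)]

@[simp]
lemma reindex_snd_assoc {B A Z W V : E} (f : B ⟶ A) {b : W ⟶ A} (g : Z ⟶ W) (a : Z ⟶ A)
    (h : g ≫ b = a) (k : B ⟶ V) : reindex f g a h ≫ snd b f ≫ k = snd a f ≫ k := by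
  rw [reassoc_of% (reindex_snd f g a h)]

lemma reindex_isPullback {B A Z W : E} (f : B ⟶ A) {b : W ⟶ A} (g : Z ⟶ W) (a : Z ⟶ A)
    (h : g ≫ b = a) : IsPullback (reindex f g a h) (fst a f) (fst b f) g := by
  refine IsPullback.of_right (h₁₂ := snd b f) (v₁₃ := f) (h₂₂ := b) ?_ (by simp)
    (isPullback b f).flip
  subst h
  simpa using (isPullback (g ≫ b) f).flip

lemma reindex_comp {B A Z W V : E} (f : B ⟶ A) {b : W ⟶ A} {c : V ⟶ A} (g : Z ⟶ W) (k : W ⟶ V)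
    (a : Z ⟶ A) (h : g ≫ b = a) (h' : k ≫ c = b) (h'' : (g ≫ k) ≫ c = a) :
    reindex f (g ≫ k) a h'' = reindex f g a h ≫ reindex f k b h' := by
  apply ChosenPullbacksAlong.hom_ext <;> simp

namespace CartHom

variable {I J : E} {F G : Poly I J}

/-- The comparison `Z ×_C D ⟶ Z ×_A B` coming from `B = A ×_C D`. -/
def pull (φ : CartHom F G) {Z : E} (a : Z ⟶ F.A) :
    pullbackObj (a ≫ φ.φ₀) G.f ⟶ pullbackObj a F.f :=
  lift (fst _ _) (φ.isPullback.lift (snd (a ≫ φ.φ₀) G.f) (fst (a ≫ φ.φ₀) G.f ≫ a)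
    (by rw [← condition, Category.assoc])) (by simp)

@[simp]
lemma pull_fst (φ : CartHom F G) {Z : E} (a : Z ⟶ F.A) :
    φ.pull a ≫ fst a F.f = fst (a ≫ φ.φ₀) G.f := lift_fst _ _ _

@[simp]
lemma pull_snd_φ₁ (φ : CartHom F G) {Z : E} (a : Z ⟶ F.A) :
    φ.pull a ≫ snd a F.f ≫ φ.φ₁ = snd (a ≫ φ.φ₀) G.f := by
  unfold pull
  rw [← Category.assoc, lift_snd _ _ _, IsPullback.lift_fst]

@[simp]
lemma pull_fst_assoc (φ : CartHom F G) {Z W : E} (a : Z ⟶ F.A) (k : Z ⟶ W) :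
    φ.pull a ≫ fst a F.f ≫ k = fst (a ≫ φ.φ₀) G.f ≫ k := by
  rw [reassoc_of% (φ.pull_fst a)]

@[simp]
lemma pull_snd_φ₁_assoc (φ : CartHom F G) {Z W : E} (a : Z ⟶ F.A) (k : G.B ⟶ W) :
    φ.pull a ≫ snd a F.f ≫ φ.φ₁ ≫ k = snd (a ≫ φ.φ₀) G.f ≫ k := by
  rw [reassoc_of% (φ.pull_snd_φ₁ a)]

lemma pull_snd_s (φ : CartHom F G) {Z : E} (a : Z ⟶ F.A) :
    φ.pull a ≫ snd a F.f ≫ F.s = snd (a ≫ φ.φ₀) G.f ≫ G.s := by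
  rw [← φ.w_s, pull_snd_φ₁_assoc]

lemma pull_hom_ext (φ : CartHom F G) {Z W : E} {a : Z ⟶ F.A} {k l : W ⟶ pullbackObj a F.f}
    (h : k ≫ fst a F.f = l ≫ fst a F.f)
    (h' : k ≫ snd a F.f ≫ φ.φ₁ = l ≫ snd a F.f ≫ φ.φ₁) : k = l := by
  apply ChosenPullbacksAlong.hom_ext _ _ h
  apply φ.isPullback.hom_ext
  · simpa using h'
  · rw [Category.assoc, Category.assoc, ← condition, reassoc_of% h]

end CartHom

variable [∀ {X Y : E} (f : X ⟶ Y), ExponentiableMorphism f]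

namespace Poly

variable {I J K L : E}

/-- The extension `P_F = Σ_t Π_f Δ_s` of a polynomial. -/
def extension (F : Poly I J) : Over I ⥤ Over J :=
  pullback F.s ⋙ pushforward F.f ⋙ Over.map F.t

/-- `Π_f Δ_s X` as an object over `A`. -/
abbrev piObj (F : Poly I J) (X : Over I) : Over F.A := (pushforward F.f).obj ((pullback F.s).obj X)

/-- The projection `P_F(X) ⟶ A`. -/
def base (F : Poly I J) (X : Over I) : (F.extension.obj X).left ⟶ F.A := (F.piObj X).hom

lemma base_t (F : Poly I J) (X : Over I) : F.base X ≫ F.t = (F.extension.obj X).hom := rfl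

lemma map_base (F : Poly I J) {X Y : Over I} (g : X ⟶ Y) :
    (F.extension.map g).left ≫ F.base Y = F.base X :=
  Over.w ((pushforward F.f).map ((pullback F.s).map g))

lemma map_base_assoc (F : Poly I J) {X Y : Over I} (g : X ⟶ Y) {W : E} (l : F.A ⟶ W) :
    (F.extension.map g).left ≫ F.base Y ≫ l = F.base X ≫ l := by
  rw [reassoc_of% (F.map_base g)]

/-- The counit of `Δ_f ⊣ Π_f` at `Δ_s X`. -/
def evalPullback (F : Poly I J) (X : Over I) :
    pullbackObj (F.base X) F.f ⟶ pullbackObj X.hom F.s :=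
  ((ev F.f).app ((pullback F.s).obj X)).left

lemma evalPullback_snd (F : Poly I J) (X : Over I) :
    F.evalPullback X ≫ snd X.hom F.s = snd (F.base X) F.f :=
  Over.w ((ev F.f).app ((pullback F.s).obj X))

/-- Evaluation `P_F(X) ×_A B ⟶ X`, given by the counit of `Δ_f ⊣ Π_f`. -/
def eval (F : Poly I J) (X : Over I) : pullbackObj (F.base X) F.f ⟶ X.left :=
  F.evalPullback X ≫ fst X.hom F.s

lemma eval_hom (F : Poly I J) (X : Over I) :
    F.eval X ≫ X.hom = snd (F.base X) F.f ≫ F.s := by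
  rw [eval, Category.assoc, condition, reassoc_of% (F.evalPullback_snd X)]

/-- The map `Z ⟶ P_F(X)` given by `a : Z ⟶ A` and a map `Z ×_A B ⟶ X` over `I`. -/
def toExt (F : Poly I J) {X : Over I} {Z : E} (a : Z ⟶ F.A) (k : pullbackObj a F.f ⟶ X.left)
    (hk : k ≫ X.hom = snd a F.f ≫ F.s) : Z ⟶ (F.extension.obj X).left :=
  (pushforwardCurry (f := F.f) (A := Over.mk a) (X := (pullback F.s).obj X)
    (Over.homMk (lift k (snd a F.f) hk) (lift_snd _ _ _))).left

@[simp]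
lemma toExt_base (F : Poly I J) {X : Over I} {Z : E} (a : Z ⟶ F.A) (k : pullbackObj a F.f ⟶ X.left)
    (hk : k ≫ X.hom = snd a F.f ≫ F.s) : F.toExt a k hk ≫ F.base X = a :=
  Over.w (pushforwardCurry (f := F.f) (A := Over.mk a) (X := (pullback F.s).obj X)
    (Over.homMk (lift k (snd a F.f) hk) (lift_snd _ _ _)))

@[simp]
lemma toExt_base_assoc (F : Poly I J) {X : Over I} {Z W : E} (a : Z ⟶ F.A)
    (k : pullbackObj a F.f ⟶ X.left) (hk : k ≫ X.hom = snd a F.f ≫ F.s) (l : F.A ⟶ W) :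
    F.toExt a k hk ≫ F.base X ≫ l = a ≫ l := by
  rw [reassoc_of% (F.toExt_base a k hk)]

lemma reindex_evalPullback (F : Poly I J) {X : Over I} {Z : E} (m : Z ⟶ (F.extension.obj X).left)
    (a : Z ⟶ F.A) (h : m ≫ F.base X = a) :
    reindex F.f m a h ≫ F.evalPullback X =
      (pushforwardUncurry (f := F.f) (A := Over.mk a) (X := (pullback F.s).obj X)
        (Over.homMk m h)).left := by
  have e := congrArg CommaMorphism.left ((pullbackPushforwardAdj F.f).homEquiv_counit
    (X := Over.mk a) (Y := (pullback F.s).obj X) (g := Over.homMk m h))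
  refine Eq.trans ?_ e.symm
  refine congrArg (· ≫ F.evalPullback X) ?_
  apply ChosenPullbacksAlong.hom_ext
  · rw [reindex_fst]
    exact (congrArg CommaMorphism.left
      ((mapPullbackAdj F.f).counit.naturality (Over.homMk m h : Over.mk a ⟶ F.piObj X))).symm
  · rw [reindex_snd]
    exact (Over.w ((pullback F.f).map (Over.homMk m h : Over.mk a ⟶ F.piObj X))).symm

lemma toExt_eval (F : Poly I J) {X : Over I} {Z : E} (a : Z ⟶ F.A) (k : pullbackObj a F.f ⟶ X.left)
    (hk : k ≫ X.hom = snd a F.f ≫ F.s) :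
    reindex F.f (F.toExt a k hk) a (F.toExt_base a k hk) ≫ F.eval X = k := by
  have e : (Over.homMk (F.toExt a k hk) (F.toExt_base a k hk) : Over.mk a ⟶ F.piObj X) =
    pushforwardCurry (f := F.f) (A := Over.mk a) (X := (pullback F.s).obj X)
      (Over.homMk (lift k (snd a F.f) hk) (lift_snd _ _ _)) := by
    ext; rfl
  rw [eval, ← Category.assoc, reindex_evalPullback, e, pushforward_uncurry_curry]
  exact lift_fst k (snd a F.f) hk

lemma extension_hom_ext (F : Poly I J) {X : Over I} {Z : E} {m m' : Z ⟶ (F.extension.obj X).left}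
    (a : Z ⟶ F.A) (h : m ≫ F.base X = a) (h' : m' ≫ F.base X = a)
    (he : reindex F.f m a h ≫ F.eval X = reindex F.f m' a h' ≫ F.eval X) : m = m' := by
  have key : reindex F.f m a h ≫ F.evalPullback X = reindex F.f m' a h' ≫ F.evalPullback X := by
    apply ChosenPullbacksAlong.hom_ext
    · simpa [eval] using he
    · simp [evalPullback_snd]
  rw [reindex_evalPullback, reindex_evalPullback] at key
  have key' := congrArg (pushforwardCurry (f := F.f)) (Over.OverMorphism.ext key)
  rw [pushforward_curry_uncurry, pushforward_curry_uncurry] at key'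
  exact congrArg CommaMorphism.left key'

lemma reindex_map_eval (F : Poly I J) {X Y : Over I} (g : X ⟶ Y) :
    reindex F.f (F.extension.map g).left (F.base X) (F.map_base g) ≫ F.eval Y =
      F.eval X ≫ g.left := by
  have h : _ ≫ F.evalPullback Y = F.evalPullback X ≫ ((pullback F.s).map g).left :=
    congrArg CommaMorphism.left (ev_naturality (f := F.f) ((pullback F.s).map g))
  have h₂ : ((pullback F.s).map g).left ≫ fst Y.hom F.s = fst X.hom F.s ≫ g.left :=
    congrArg CommaMorphism.left ((mapPullbackAdj F.s).counit.naturality g)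
  have e₁ : reindex F.f (F.extension.map g).left (F.base X) (F.map_base g) =
      ((pullback F.f).map ((pushforward F.f).map ((pullback F.s).map g))).left := by
    apply ChosenPullbacksAlong.hom_ext
    · rw [reindex_fst]
      exact (congrArg CommaMorphism.left ((mapPullbackAdj F.f).counit.naturality
        ((pushforward F.f).map ((pullback F.s).map g)))).symm
    · rw [reindex_snd]
      exact (Over.w ((pullback F.f).map ((pushforward F.f).map ((pullback F.s).map g)))).symm
  rw [eval, eval, Category.assoc, ← h₂, ← Category.assoc, ← Category.assoc, e₁]
  exact congrArg (· ≫ fst Y.hom F.s) h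

end Poly


/-! ### The action of the extension on cartesian morphisms -/

namespace CartHom

variable {I J : E} {F G : Poly I J}

/-- The component at `X` of the natural transformation `P_F ⟶ P_G` induced by a cartesian
morphism: `(a, k) ↦ (φ₀(a), k ∘ (φ₁)_a⁻¹)`. -/
def extApp (φ : CartHom F G) (X : Over I) : (F.extension.obj X).left ⟶ (G.extension.obj X).left :=
  G.toExt (F.base X ≫ φ.φ₀) (φ.pull (F.base X) ≫ F.eval X)
    (by rw [Category.assoc, F.eval_hom, pull_snd_s])

@[simp]
lemma extApp_base (φ : CartHom F G) (X : Over I) :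
    φ.extApp X ≫ G.base X = F.base X ≫ φ.φ₀ := G.toExt_base _ _ _

@[simp]
lemma extApp_base_assoc (φ : CartHom F G) (X : Over I) {W : E} (k : G.A ⟶ W) :
    φ.extApp X ≫ G.base X ≫ k = F.base X ≫ φ.φ₀ ≫ k := by
  rw [reassoc_of% (φ.extApp_base X)]

lemma extApp_eval (φ : CartHom F G) (X : Over I) :
    reindex G.f (φ.extApp X) (F.base X ≫ φ.φ₀) (φ.extApp_base X) ≫ G.eval X =
      φ.pull (F.base X) ≫ F.eval X := G.toExt_eval _ _ _

/-- The natural transformation `P_F ⟶ P_G` induced by a cartesian morphism `F ⟶ G`. -/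
def extension (φ : CartHom F G) : F.extension ⟶ G.extension where
  app X := Over.homMk (φ.extApp X) (by
    rw [← G.base_t, extApp_base_assoc, φ.w_t, F.base_t])
  naturality X Y g := by
    apply Over.OverMorphism.ext
    refine G.extension_hom_ext (F.base X ≫ φ.φ₀) ?_ ?_ ?_
    · simp [Poly.map_base_assoc]
    · simp [Poly.map_base]
    · have h₁ := reindex_comp G.f (F.extension.map g).left (φ.extApp Y) (F.base X ≫ φ.φ₀)
        (by rw [F.map_base_assoc]) (φ.extApp_base Y) (by simp [Poly.map_base_assoc])
      have h₂ := reindex_comp G.f (φ.extApp X) (G.extension.map g).left (F.base X ≫ φ.φ₀)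
        (φ.extApp_base X) (G.map_base g) (by simp [Poly.map_base])
      refine (congrArg (· ≫ G.eval Y) h₁).trans (Eq.trans ?_ (congrArg (· ≫ G.eval Y) h₂).symm)
      simp only [Category.assoc]
      rw [extApp_eval, G.reindex_map_eval, reassoc_of% (φ.extApp_eval X)]
      refine Eq.trans ?_ (congrArg (φ.pull (F.base X) ≫ ·) (F.reindex_map_eval g))
      refine (Category.assoc _ _ _).symm.trans (Eq.trans ?_ (Category.assoc _ _ _))
      refine congrArg (· ≫ F.eval Y) ?_
      apply φ.pull_hom_ext
      · simp
      · simp only [Category.assoc, reindex_snd_assoc, pull_snd_φ₁]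
        exact reindex_snd _ _ _ _

end CartHom

namespace Poly

variable {I J K L : E}

/-! ### Composition of polynomials -/

/-- Evaluation at the `A` of a polynomial `F`; this is the map `• ⟶ A` in the construction of
`G · F`, namely the counit of `Δ_g ⊣ Π_g` at `A ×_J D ⟶ D` followed by the projection to `A`. -/
def evalCod (G : Poly J K) (F : Poly I J) : pullbackObj (G.base F.cod) G.f ⟶ F.A := G.eval F.cod

/-- The composite `G · F` of polynomials `F` from `I` to `J` and `G` from `J` to `K`. -/
abbrev comp (G : Poly J K) (F : Poly I J) : Poly I K where
  B := pullbackObj F.f (G.evalCod F)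
  A := (G.extension.obj F.cod).left
  s := fst F.f (G.evalCod F) ≫ F.s
  f := snd F.f (G.evalCod F) ≫ fst (G.base F.cod) G.f
  t := (G.extension.obj F.cod).hom

/-- The action of `φ : F ⟶ F'` on `P_G(A) ×_C D`. -/
def whiskerLeftAux (G : Poly J K) {F F' : Poly I J} (φ : CartHom F F') :
    pullbackObj (G.base F.cod) G.f ⟶ pullbackObj (G.base F'.cod) G.f :=
  reindex G.f (G.extension.map φ.cod).left _ (G.map_base φ.cod)

lemma whiskerLeftAux_eval (G : Poly J K) {F F' : Poly I J} (φ : CartHom F F') :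
    G.whiskerLeftAux φ ≫ G.evalCod F' = G.evalCod F ≫ φ.φ₀ :=
  G.reindex_map_eval φ.cod

/-- The action of `φ : F ⟶ F'` on `N`. -/
def whiskerLeft₁ (G : Poly J K) {F F' : Poly I J} (φ : CartHom F F') :
    pullbackObj F.f (G.evalCod F) ⟶ pullbackObj F'.f (G.evalCod F') :=
  lift (fst F.f (G.evalCod F) ≫ φ.φ₁) (snd F.f (G.evalCod F) ≫ G.whiskerLeftAux φ) (by
    rw [Category.assoc, Category.assoc, whiskerLeftAux_eval, φ.isPullback.w, condition_assoc])

lemma whiskerLeft₁_fst (G : Poly J K) {F F' : Poly I J} (φ : CartHom F F') :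
    G.whiskerLeft₁ φ ≫ fst F'.f (G.evalCod F') = fst F.f (G.evalCod F) ≫ φ.φ₁ := lift_fst _ _ _

/-- The whiskering `G · φ : G · F ⟶ G · F'`. -/
def whiskerLeft (G : Poly J K) {F F' : Poly I J} (φ : CartHom F F') :
    CartHom (G.comp F) (G.comp F') where
  φ₀ := (G.extension.map φ.cod).left
  φ₁ := G.whiskerLeft₁ φ
  isPullback := by
    refine IsPullback.paste_vert (v₁₁ := snd F.f (G.evalCod F)) (v₁₂ := snd _ _) ?_
      (reindex_isPullback G.f _ _ (G.map_base φ.cod))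
    refine IsPullback.of_right (h₁₂ := fst F'.f (G.evalCod F')) (v₁₃ := F'.f)
      (h₂₂ := G.evalCod F') ?_ (lift_snd _ _ _) (isPullback _ _)
    have h := (isPullback F.f (G.evalCod F)).flip.flip.paste_horiz φ.isPullback
    rw [← whiskerLeftAux_eval] at h
    rw [whiskerLeft₁_fst]
    exact h
  w_s := by
    change G.whiskerLeft₁ φ ≫ fst F'.f (G.evalCod F') ≫ F'.s = fst F.f (G.evalCod F) ≫ F.s
    rw [reassoc_of% (G.whiskerLeft₁_fst φ), φ.w_s]
  w_t := Over.w (G.extension.map φ.cod)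

/-- The action of `ψ : G ⟶ G'` on `P_G(A) ×_C D`. -/
def whiskerRightAux {G G' : Poly J K} (ψ : CartHom G G') (F : Poly I J) :
    pullbackObj (G.base F.cod) G.f ⟶ pullbackObj (G'.base F.cod) G'.f :=
  lift (fst _ _ ≫ ψ.extApp F.cod) (snd _ _ ≫ ψ.φ₁) (by
    rw [Category.assoc, Category.assoc, ψ.extApp_base, ψ.isPullback.w, condition_assoc])

lemma whiskerRightAux_eval {G G' : Poly J K} (ψ : CartHom G G') (F : Poly I J) :
    whiskerRightAux ψ F ≫ G'.evalCod F = G.evalCod F := by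
  let e : pullbackObj (G.base F.cod) G.f ⟶ pullbackObj (G.base F.cod ≫ ψ.φ₀) G'.f :=
    lift (fst _ _) (snd _ _ ≫ ψ.φ₁) (by rw [Category.assoc, ψ.isPullback.w, condition_assoc])
  have h₁ : whiskerRightAux ψ F =
      e ≫ reindex G'.f (ψ.extApp F.cod) (G.base F.cod ≫ ψ.φ₀) (ψ.extApp_base F.cod) := by
    apply ChosenPullbacksAlong.hom_ext <;> simp [whiskerRightAux, e]
  have h₂ : e ≫ ψ.pull (G.base F.cod) = 𝟙 _ := by
    apply ψ.pull_hom_ext <;> simp [e]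
  rw [h₁, Category.assoc]
  refine (congrArg (e ≫ ·) (ψ.extApp_eval F.cod)).trans ?_
  rw [reassoc_of% h₂]
  rfl

lemma whiskerRightAux_isPullback {G G' : Poly J K} (ψ : CartHom G G') (F : Poly I J) :
    IsPullback (whiskerRightAux ψ F) (fst (G.base F.cod) G.f) (fst (G'.base F.cod) G'.f)
      (ψ.extApp F.cod) := by
  refine IsPullback.of_right (h₁₂ := snd (G'.base F.cod) G'.f) (v₁₃ := G'.f)
    (h₂₂ := G'.base F.cod) ?_ (lift_fst _ _ _) (isPullback _ _).flip
  have h := (isPullback (G.base F.cod) G.f).flip.paste_horiz ψ.isPullback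
  rw [← ψ.extApp_base] at h
  rw [whiskerRightAux, lift_snd _ _ _]
  exact h

/-- The action of `ψ : G ⟶ G'` on `N`. -/
def whiskerRight₁ {G G' : Poly J K} (ψ : CartHom G G') (F : Poly I J) :
    pullbackObj F.f (G.evalCod F) ⟶ pullbackObj F.f (G'.evalCod F) :=
  lift (fst F.f (G.evalCod F)) (snd F.f (G.evalCod F) ≫ whiskerRightAux ψ F) (by
    rw [Category.assoc, whiskerRightAux_eval, condition])

lemma whiskerRight₁_fst {G G' : Poly J K} (ψ : CartHom G G') (F : Poly I J) :
    whiskerRight₁ ψ F ≫ fst F.f (G'.evalCod F) = fst F.f (G.evalCod F) := lift_fst _ _ _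

/-- The whiskering `ψ · F : G · F ⟶ G' · F`. -/
def whiskerRight {G G' : Poly J K} (ψ : CartHom G G') (F : Poly I J) :
    CartHom (G.comp F) (G'.comp F) where
  φ₀ := (ψ.extension.app F.cod).left
  φ₁ := whiskerRight₁ ψ F
  isPullback := by
    refine IsPullback.paste_vert (v₁₁ := snd F.f (G.evalCod F)) (v₁₂ := snd _ _) ?_
      (whiskerRightAux_isPullback ψ F)
    refine IsPullback.of_right (h₁₂ := fst F.f (G'.evalCod F)) (v₁₃ := F.f)
      (h₂₂ := G'.evalCod F) ?_ (lift_snd _ _ _) (isPullback _ _)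
    rw [whiskerRight₁_fst, whiskerRightAux_eval]
    exact isPullback _ _
  w_s := by
    change whiskerRight₁ ψ F ≫ fst F.f (G'.evalCod F) ≫ F.s = fst F.f (G.evalCod F) ≫ F.s
    rw [reassoc_of% (whiskerRight₁_fst ψ F)]
  w_t := Over.w (ψ.extension.app F.cod)


/-! ### Unitors and associator -/

/-- The unitor `F · i_I ⟶ F`. -/
def rightUnit (F : Poly I J) : CartHom (F.comp (ident I)) F where
  φ₀ := F.base (ident I).cod
  φ₁ := snd (ident I).f (F.evalCod (ident I)) ≫ snd (F.base (ident I).cod) F.f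
  isPullback := by
    have h := isPullback (ident I).f (F.evalCod (ident I))
    have : IsIso (snd (ident I).f (F.evalCod (ident I))) :=
      h.isIso_snd_of_isIso (inferInstanceAs (IsIso (𝟙 I)))
    have h' := (IsPullback.of_horiz_isIso (fst := snd (ident I).f (F.evalCod (ident I)))
      (snd := snd (ident I).f (F.evalCod (ident I)) ≫ fst (F.base (ident I).cod) F.f)
      (f := fst (F.base (ident I).cod) F.f) (g := 𝟙 _) ⟨by simp⟩).paste_horiz
      (isPullback (F.base (ident I).cod) F.f).flip
    rw [Category.id_comp] at h'
    exact h'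
  w_s := by
    have h₁ : F.evalCod (ident I) ≫ 𝟙 I = snd (F.base (ident I).cod) F.f ≫ F.s := F.eval_hom _
    have h₂ := condition (f := (ident I).f) (g := F.evalCod (ident I))
    change (_ ≫ _) ≫ F.s = fst (ident I).f (F.evalCod (ident I)) ≫ 𝟙 I
    rw [Category.assoc, ← h₁, Category.comp_id]
    exact h₂.symm
  w_t := rfl

/-- The isomorphism `P_{i_J}(X) ≅ P_{i_J}(X) ×_J J`. -/
def identSection {J : E} (X : Over J) :
    ((ident J).extension.obj X).left ≅ pullbackObj ((ident J).base X) (𝟙 J) where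
  hom := lift (𝟙 _) ((ident J).base X) (by simp)
  inv := fst _ _
  hom_inv_id := lift_fst _ _ _
  inv_hom_id := by
    apply ChosenPullbacksAlong.hom_ext
    · rw [Category.assoc, lift_fst _ _ _, Category.comp_id, Category.id_comp]
    · rw [Category.assoc, lift_snd _ _ _, condition, Category.comp_id, Category.id_comp]

lemma identSection_snd {J : E} (X : Over J) :
    (identSection X).hom ≫ snd ((ident J).base X) (𝟙 J) = (ident J).base X := by
  simp [identSection]

/-- The unitor `i_J · F ⟶ F`. -/
def leftUnit (F : Poly I J) : CartHom ((ident J).comp F) F where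
  φ₀ := (identSection F.cod).hom ≫ (ident J).evalCod F
  φ₁ := fst F.f ((ident J).evalCod F)
  isPullback := by
    refine IsPullback.of_iso (isPullback F.f ((ident J).evalCod F)) (Iso.refl _) (Iso.refl _)
      (identSection F.cod).symm (Iso.refl _) ?_ ?_ ?_ ?_
    · simp
    · exact (Category.id_comp _).symm
    · simp
    · simp
  w_s := rfl
  w_t := by
    have h : (ident J).evalCod F ≫ F.t = snd ((ident J).base F.cod) (ident J).f ≫ 𝟙 J :=
      (ident J).eval_hom F.cod
    rw [Category.assoc, h, Category.comp_id, identSection_snd]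
    exact (Category.comp_id _ : (ident J).base F.cod ≫ 𝟙 J = _).symm

/-- The comparison `X ⟶ P_{i_I}(X)`. -/
def extUnit {I : E} (X : Over I) : X ⟶ (ident I).extension.obj X :=
  Over.homMk ((ident I).toExt X.hom (fst X.hom (𝟙 I)) condition) (by
    rw [← base_t, toExt_base_assoc]
    exact Category.comp_id _)

/-- The projection `P_F(X) ⟶ A` over `J`. -/
def baseOver (F : Poly I J) (X : Over I) : F.extension.obj X ⟶ F.cod :=
  Over.homMk (F.base X) (F.base_t X)

section

variable (G : Poly J K) (F : Poly I J) (X : Over I)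

/-- The map `P_G(P_F(X)) ⟶ P_G(A)`, `(c, l) ↦ (c, d ↦ base (l(d)))`. -/
def extCompBase : (G.extension.obj (F.extension.obj X)).left ⟶ (G.comp F).A :=
  (G.extension.map (F.baseOver X)).left

lemma extCompBase_base : G.extCompBase F X ≫ G.base F.cod = G.base (F.extension.obj X) :=
  G.map_base (F.baseOver X)

/-- The action of `P_G(P_F(X)) ⟶ P_G(A)` on fibres of `g`. -/
def extCompFib : pullbackObj (G.base (F.extension.obj X)) G.f ⟶ pullbackObj (G.base F.cod) G.f :=
  reindex G.f (G.extCompBase F X) (G.base (F.extension.obj X)) (G.extCompBase_base F X)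

lemma extCompFib_eval : G.extCompFib F X ≫ G.evalCod F = G.eval (F.extension.obj X) ≫ F.base X :=
  G.reindex_map_eval (F.baseOver X)

/-- The pullback of `N ⟶ M` along `P_G(P_F(X)) ⟶ P_G(A) = M`. -/
abbrev extCompObj : E :=
  pullbackObj (G.extCompBase F X) (snd F.f (G.evalCod F) ≫ fst (G.base F.cod) G.f)

/-- The projection of `extCompObj` to `N`. -/
abbrev extCompN : G.extCompObj F X ⟶ pullbackObj F.f (G.evalCod F) :=
  snd (G.extCompBase F X) (snd F.f (G.evalCod F) ≫ fst (G.base F.cod) G.f)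

/-- The projection `((c, l), (d, b)) ↦ ((c, l), d)`. -/
def extCompD : G.extCompObj F X ⟶ pullbackObj (G.base (F.extension.obj X)) G.f :=
  lift (fst _ _) (G.extCompN F X ≫ snd F.f (G.evalCod F) ≫ snd (G.base F.cod) G.f) (by
    rw [← extCompBase_base, condition_assoc]
    simp only [Category.assoc, condition])

lemma extCompD_fst : G.extCompD F X ≫ fst _ _ = fst _ _ := lift_fst _ _ _

lemma extCompD_snd : G.extCompD F X ≫ snd _ _ =
    G.extCompN F X ≫ snd F.f (G.evalCod F) ≫ snd (G.base F.cod) G.f := lift_snd _ _ _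

lemma extCompD_fib : G.extCompD F X ≫ G.extCompFib F X =
    G.extCompN F X ≫ snd F.f (G.evalCod F) := by
  apply ChosenPullbacksAlong.hom_ext
  · rw [Category.assoc, extCompFib, reindex_fst, reassoc_of% (G.extCompD_fst F X), condition]
    simp only [Category.assoc]
  · rw [Category.assoc, extCompFib, reindex_snd, extCompD_snd, Category.assoc]

/-- The map `((c, l), (d, b)) ↦ (l(d), b)`. -/
def extCompPair : G.extCompObj F X ⟶ pullbackObj (F.base X) F.f :=
  lift (G.extCompD F X ≫ G.eval (F.extension.obj X)) (G.extCompN F X ≫ fst F.f (G.evalCod F)) (by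
    rw [Category.assoc, ← extCompFib_eval, reassoc_of% (G.extCompD_fib F X), Category.assoc, condition])

lemma extCompPair_fst : G.extCompPair F X ≫ fst (F.base X) F.f =
    G.extCompD F X ≫ G.eval (F.extension.obj X) := lift_fst _ _ _

lemma extCompPair_snd : G.extCompPair F X ≫ snd (F.base X) F.f =
    G.extCompN F X ≫ fst F.f (G.evalCod F) := lift_snd _ _ _

lemma extCompPair_isPullback : IsPullback (G.extCompPair F X) (G.extCompD F X)
    (fst (F.base X) F.f) (G.eval (F.extension.obj X)) := by
  have h₁ : IsPullback (G.extCompN F X) (G.extCompD F X) (snd F.f (G.evalCod F))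
      (G.extCompFib F X) := by
    refine IsPullback.of_bot (h₃₁ := G.extCompBase F X)
      (v₂₁ := fst _ _) (v₂₂ := fst (G.base F.cod) G.f) ?_ (G.extCompD_fib F X).symm
      (reindex_isPullback G.f _ _ (G.extCompBase_base F X))
    rw [extCompD_fst]
    exact (isPullback _ _).flip
  have h₂ := h₁.flip.paste_vert (isPullback F.f (G.evalCod F)).flip
  rw [← extCompPair_snd, extCompFib_eval] at h₂
  exact (IsPullback.of_bot h₂ (G.extCompPair_fst F X).symm (isPullback (F.base X) F.f)).flip

/-- The comparison `P_G(P_F(X)) ⟶ P_{G · F}(X)`. In the internal language it sends `(c, l)`, with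
`l(d) = (a_d, k_d)`, to `((c, d ↦ a_d), (d, b) ↦ k_d(b))`. -/
def extComp : G.extension.obj (F.extension.obj X) ⟶ (G.comp F).extension.obj X :=
  Over.homMk ((G.comp F).toExt (G.extCompBase F X) (G.extCompPair F X ≫ F.eval X) (by
    rw [Category.assoc, eval_hom, reassoc_of% (G.extCompPair_snd F X)])) (by
    rw [← base_t, toExt_base_assoc]
    exact Over.w (G.extension.map (F.baseOver X)))

end

section

variable (H : Poly K L) (G : Poly J K) (F : Poly I J)

/-- The map `P_H(P_G(A)) ⟶ P_{H · G}(A)`. -/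
def assocInv₀ : (H.comp (G.comp F)).A ⟶ ((H.comp G).comp F).A := (H.extComp G F.cod).left

lemma assocInv₀_base : H.assocInv₀ G F ≫ (H.comp G).base F.cod = H.extCompBase G F.cod :=
  (H.comp G).toExt_base _ _ _

/-- The map induced by `P_H(P_G(A)) ⟶ P_{H · G}(A)` on fibres. -/
def assocInvFib : H.extCompObj G F.cod ⟶ pullbackObj ((H.comp G).base F.cod) (H.comp G).f :=
  reindex (H.comp G).f (H.assocInv₀ G F) (H.extCompBase G F.cod) (H.assocInv₀_base G F)

lemma assocInvFib_eval : H.assocInvFib G F ≫ (H.comp G).evalCod F =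
    H.extCompPair G F.cod ≫ G.evalCod F := (H.comp G).toExt_eval _ _ _

/-- The domain of the map `f` of the composite `H · (G · F)`. -/
abbrev assocObj : E := pullbackObj (G.comp F).f (H.evalCod (G.comp F))

/-- The map `(d, e) ↦ (H-shape of the first component, e)` into the domain of `f` of `H · G`. -/
def assocN : H.assocObj G F ⟶ pullbackObj G.f (H.evalCod G) :=
  lift (fst (G.comp F).f (H.evalCod (G.comp F)) ≫ snd F.f (G.evalCod F) ≫ snd (G.base F.cod) G.f)
    (snd (G.comp F).f (H.evalCod (G.comp F)) ≫ H.extCompFib G F.cod) (by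
      refine Eq.trans ?_ ((congrArg (snd (G.comp F).f (H.evalCod (G.comp F)) ≫ ·)
        (H.extCompFib_eval G F.cod)).symm.trans (Category.assoc _ _ _).symm)
      refine Eq.trans ?_ ((congrArg (· ≫ G.base F.cod)
        (condition (f := (G.comp F).f) (g := H.evalCod (G.comp F)))).trans (Category.assoc _ _ _))
      simp only [Category.assoc, ← condition (f := G.base F.cod) (g := G.f)])

lemma assocN_snd : H.assocN G F ≫ snd G.f (H.evalCod G) =
    snd (G.comp F).f (H.evalCod (G.comp F)) ≫ H.extCompFib G F.cod := by
  simp [assocN]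

lemma assocN_fst : H.assocN G F ≫ fst G.f (H.evalCod G) =
    fst (G.comp F).f (H.evalCod (G.comp F)) ≫ snd F.f (G.evalCod F) ≫ snd (G.base F.cod) G.f := by
  simp [assocN]

/-- The map from the domain of `f` of `H · (G · F)` to the fibres of `H · G`. -/
def assocS : H.assocObj G F ⟶ H.extCompObj G F.cod :=
  lift (snd (G.comp F).f (H.evalCod (G.comp F)) ≫ fst _ _) (H.assocN G F) (by
    rw [reassoc_of% (H.assocN_snd G F), extCompFib, reindex_fst, Category.assoc]
    rfl)

lemma assocS_fst : H.assocS G F ≫ fst _ _ = snd (G.comp F).f (H.evalCod (G.comp F)) ≫ fst _ _ :=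
  lift_fst _ _ _

lemma assocS_N : H.assocS G F ≫ H.extCompN G F.cod = H.assocN G F := lift_snd _ _ _

lemma assocS_D : H.assocS G F ≫ H.extCompD G F.cod = snd (G.comp F).f (H.evalCod (G.comp F)) := by
  apply ChosenPullbacksAlong.hom_ext
  · rw [Category.assoc, extCompD_fst, assocS_fst]
    rfl
  · rw [Category.assoc, extCompD_snd, reassoc_of% (H.assocS_N G F), reassoc_of% (H.assocN_snd G F)]
    simp [extCompFib]

lemma assocS_pair : H.assocS G F ≫ H.extCompPair G F.cod =
    fst (G.comp F).f (H.evalCod (G.comp F)) ≫ snd F.f (G.evalCod F) := by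
  apply ChosenPullbacksAlong.hom_ext
  · rw [Category.assoc, extCompPair_fst, reassoc_of% (H.assocS_D G F)]
    have h := condition (f := (G.comp F).f) (g := H.evalCod (G.comp F))
    simp only [Category.assoc] at h ⊢
    exact h.symm
  · rw [Category.assoc, extCompPair_snd, reassoc_of% (H.assocS_N G F), assocN_fst, Category.assoc]

lemma assocS_isPullback : IsPullback (H.assocS G F)
    (fst (G.comp F).f (H.evalCod (G.comp F))) (H.extCompPair G F.cod) (snd F.f (G.evalCod F)) := by
  have h := (isPullback (G.comp F).f (H.evalCod (G.comp F))).flip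
  rw [← assocS_D] at h
  exact IsPullback.of_right h (H.assocS_pair G F) (H.extCompPair_isPullback G F.cod).flip

/-- The action of the associator on the domains of the maps `f`. -/
def assocInv₁ : H.assocObj G F ⟶ pullbackObj F.f ((H.comp G).evalCod F) :=
  lift (fst _ _ ≫ fst F.f (G.evalCod F)) (H.assocS G F ≫ H.assocInvFib G F) (by
    rw [Category.assoc, Category.assoc, condition, assocInvFib_eval,
      reassoc_of% (H.assocS_pair G F)])

lemma assocInv₁_isPullback : IsPullback (H.assocInv₁ G F) (H.assocS G F)
    (snd F.f ((H.comp G).evalCod F)) (H.assocInvFib G F) := by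
  refine IsPullback.of_right (h₁₂ := fst F.f ((H.comp G).evalCod F)) (v₁₃ := F.f)
      (h₂₂ := (H.comp G).evalCod F) ?_ (lift_snd _ _ _) (isPullback _ _)
  have h := (H.assocS_isPullback G F).flip.paste_horiz (isPullback F.f (G.evalCod F))
  rw [← assocInvFib_eval] at h
  rw [assocInv₁, lift_fst _ _ _]
  exact h

/-- The associator `H · (G · F) ⟶ (H · G) · F`. -/
def assocInv : CartHom (H.comp (G.comp F)) ((H.comp G).comp F) where
  φ₀ := H.assocInv₀ G F
  φ₁ := H.assocInv₁ G F
  isPullback := by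
    have h := (H.assocInv₁_isPullback G F).paste_vert
      (reindex_isPullback (H.comp G).f (H.assocInv₀ G F) (H.extCompBase G F.cod)
        (H.assocInv₀_base G F))
    rw [assocS_fst] at h
    exact h
  w_s := by
    change H.assocInv₁ G F ≫ fst F.f ((H.comp G).evalCod F) ≫ F.s =
      fst (G.comp F).f (H.evalCod (G.comp F)) ≫ fst F.f (G.evalCod F) ≫ F.s
    have h : H.assocInv₁ G F ≫ fst F.f ((H.comp G).evalCod F) =
      fst (G.comp F).f (H.evalCod (G.comp F)) ≫ fst F.f (G.evalCod F) := lift_fst _ _ _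
    rw [reassoc_of% h]
  w_t := Over.w (H.extComp G F.cod)

end

end Poly

end


/-! ### Polynomial pseudomonads -/

noncomputable section

variable {E : Type u} [Category.{v} E] [ChosenPullbacks E]
  [∀ {X Y : E} (f : X ⟶ Y), ExponentiableMorphism f]

/-- A polynomial pseudomonad on `I`: a pseudomonad, with underlying `0`-cell `I`, in the
`2Cat`-enriched bicategory of polynomials, cartesian morphisms and adjustments. The coherence
equations for `α`, `lam` and `rho` are equations between parallel adjustments of cartesian
morphisms; they hold by `adj_subsingleton` and so need not be listed. -/
structure PolynomialPseudomonad (I : E) where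
  p : Poly I I
  η : Poly.ident I ⟶ p
  μ : p.comp p ⟶ p
  /-- `μ ∘ (p · μ) ≅ μ ∘ (μ · p)`, where `p · (p · p)` and `(p · p) · p` are identified by the
  associator. -/
  α : (p.whiskerLeft μ : p.comp (p.comp p) ⟶ p.comp p) ≫ μ ≅
    (p.assocInv p p : p.comp (p.comp p) ⟶ (p.comp p).comp p) ≫
      (Poly.whiskerRight μ p : (p.comp p).comp p ⟶ p.comp p) ≫ μ
  /-- `μ ∘ (p · η) ≅ id_p`, where `p · i_I` and `p` are identified by the unitor. -/
  lam : (p.whiskerLeft η : p.comp (Poly.ident I) ⟶ p.comp p) ≫ μ ≅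
    (p.rightUnit : p.comp (Poly.ident I) ⟶ p)
  /-- `μ ∘ (η · p) ≅ id_p`, where `i_I · p` and `p` are identified by the unitor. -/
  rho : (Poly.whiskerRight η p : (Poly.ident I).comp p ⟶ p.comp p) ≫ μ ≅
    (p.leftUnit : (Poly.ident I).comp p ⟶ p)

/-- A polynomial 2-monad is a polynomial pseudomonad whose associator and unitors are
identities. -/
def PolynomialPseudomonad.IsTwoMonad {I : E} (P : PolynomialPseudomonad I) : Prop :=
  (∃ e, P.α = eqToIso e) ∧ (∃ e, P.lam = eqToIso e) ∧ (∃ e, P.rho = eqToIso e)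

end

/-! ### Pseudomonads on a 2-category -/

section

open Bicategory

universe w v₁ u₁

variable {K : Type u₁} [Bicategory.{w, v₁} K]

/-- The image under `T` of an invertible 2-cell filling a square. -/
def mapSquare (T : Pseudofunctor K K) {a b c d : K} {f : a ⟶ b} {g : b ⟶ d} {h : a ⟶ c}
    {k : c ⟶ d} (σ : f ≫ g ≅ h ≫ k) : T.map f ≫ T.map g ≅ T.map h ≫ T.map k :=
  (T.mapComp f g).symm ≪≫ T.map₂Iso σ ≪≫ T.mapComp h k

/-- Pasting of two squares filled by invertible 2-cells. -/
def pasteSquares {a b c a' b' c' : K} {f : a ⟶ a'} {g : b ⟶ b'} {h : c ⟶ c'} {x : a ⟶ b}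
    {y : b ⟶ c} {x' : a' ⟶ b'} {y' : b' ⟶ c'} (σ : f ≫ x' ≅ x ≫ g) (τ : g ≫ y' ≅ y ≫ h) :
    f ≫ x' ≫ y' ≅ (x ≫ y) ≫ h :=
  (α_ f x' y').symm ≪≫ whiskerRightIso σ y' ≪≫ α_ x g y' ≪≫ whiskerLeftIso x τ ≪≫ (α_ x y h).symm

variable (K)

/-- A pseudomonad on a 2-category `K`: a pseudomonad, with underlying `0`-cell `K`, in the
3-category of 2-categories, 2-functors, pseudonatural transformations and modifications. The
modifications `α : μ ∘ Tμ ≅ μ ∘ μT`, `lam : μ ∘ Tη ≅ id` and `rho : μ ∘ ηT ≅ id` are given by their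
components and the modification axioms. -/
structure Pseudomonad [Bicategory.Strict K] where
  T : StrictPseudofunctor K K
  η : Pseudofunctor.StrongTrans (Pseudofunctor.id K) T.toPseudofunctor
  μ : Pseudofunctor.StrongTrans (T.toPseudofunctor.comp T.toPseudofunctor) T.toPseudofunctor
  α (X : K) : T.map (μ.app X) ≫ μ.app X ≅ μ.app (T.obj X) ≫ μ.app X
  lam (X : K) : T.map (η.app X) ≫ μ.app X ≅ 𝟙 (T.obj X)
  rho (X : K) : η.app (T.obj X) ≫ μ.app X ≅ 𝟙 (T.obj X)
  α_naturality {X Y : K} (f : X ⟶ Y) :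
    T.map (T.map (T.map f)) ◁ (α Y).hom ≫
        (pasteSquares (μ.naturality (T.map f)) (μ.naturality f)).hom =
      (pasteSquares (mapSquare T.toPseudofunctor (μ.naturality f)) (μ.naturality f)).hom ≫
        (α X).hom ▷ T.map f
  lam_naturality {X Y : K} (f : X ⟶ Y) :
    T.map f ◁ (lam Y).hom ≫ (ρ_ (T.map f)).hom ≫ (λ_ (T.map f)).inv =
      (pasteSquares (mapSquare T.toPseudofunctor (η.naturality f)) (μ.naturality f)).hom ≫
        (lam X).hom ▷ T.map f
  rho_naturality {X Y : K} (f : X ⟶ Y) :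
    T.map f ◁ (rho Y).hom ≫ (ρ_ (T.map f)).hom ≫ (λ_ (T.map f)).inv =
      (pasteSquares (η.naturality (T.map f)) (μ.naturality f)).hom ≫ (rho X).hom ▷ T.map f
  /-- The associativity coherence axiom, an equation of 2-cells from `TTμ ≫ Tμ ≫ μ` to
  `μTT ≫ μT ≫ μ`. -/
  assoc_coherence (X : K) :
    (α_ _ _ _).inv ≫ (mapSquare T.toPseudofunctor (α X)).hom ▷ μ.app X ≫ (α_ _ _ _).hom ≫
        T.map (μ.app (T.obj X)) ◁ (α X).hom ≫ (α_ _ _ _).inv ≫ (α (T.obj X)).hom ▷ μ.app X ≫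
        (α_ _ _ _).hom =
      T.map (T.map (μ.app X)) ◁ (α X).hom ≫ (α_ _ _ _).inv ≫
        (μ.naturality (μ.app X)).hom ▷ μ.app X ≫ (α_ _ _ _).hom ≫
        μ.app (T.obj (T.obj X)) ◁ (α X).hom
  /-- The unit coherence axiom, an equation of 2-cells from `TηT ≫ Tμ ≫ μ` to `μ`. -/
  unit_coherence (X : K) :
    T.map (η.app (T.obj X)) ◁ (α X).hom ≫ (α_ _ _ _).inv ≫ (lam (T.obj X)).hom ▷ μ.app X ≫
        (λ_ (μ.app X)).hom =
      (α_ _ _ _).inv ≫ (T.mapComp (η.app (T.obj X)) (μ.app X)).inv ▷ μ.app X ≫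
        T.map₂ (rho X).hom ▷ μ.app X ≫ (T.mapId (T.obj X)).hom ▷ μ.app X ≫ (λ_ (μ.app X)).hom

variable {K}

/-- A 2-monad on a 2-category: a pseudomonad whose associator and unitors are identities and whose
unit and multiplication are strictly natural. -/
structure Pseudomonad.IsTwoMonad [Bicategory.Strict K] (P : Pseudomonad K) : Prop where
  α_eq (X : K) : ∃ e, P.α X = eqToIso e
  lam_eq (X : K) : ∃ e, P.lam X = eqToIso e
  rho_eq (X : K) : ∃ e, P.rho X = eqToIso e
  η_naturality {X Y : K} (f : X ⟶ Y) : ∃ e, P.η.naturality f = eqToIso e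
  μ_naturality {X Y : K} (f : X ⟶ Y) : ∃ e, P.μ.naturality f = eqToIso e

end


/-! ### Lifts of polynomial pseudomonads -/

noncomputable section

open scoped MonoidalCategory

variable {E : Type u} [Category.{v} E] [CartesianMonoidalCategory E] [ChosenPullbacks E]
  [∀ {X Y : E} (f : X ⟶ Y), ExponentiableMorphism f]

namespace Poly

variable {I J K : E}

/-- The object `K × X` over `I`. -/
abbrev prodOver (K : E) (X : Over I) : Over I :=
  Over.mk (CartesianMonoidalCategory.snd K X.left ≫ X.hom)

/-- The projection `K × X ⟶ X` over `I`. -/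
abbrev prodSnd (K : E) (X : Over I) : prodOver K X ⟶ X :=
  Over.homMk (CartesianMonoidalCategory.snd K X.left)

/-- The strength `K × P_F(X) ⟶ P_F(K × X)`, `(k, (a, x)) ↦ (a, b ↦ (k, x(b)))`. -/
def strength (F : Poly I J) (K : E) (X : Over I) :
    K ⊗ (F.extension.obj X).left ⟶ (F.extension.obj (prodOver K X)).left :=
  F.toExt (CartesianMonoidalCategory.snd _ _ ≫ F.base X)
    (CartesianMonoidalCategory.lift (fst _ F.f ≫ CartesianMonoidalCategory.fst _ _)
      (reindex F.f (CartesianMonoidalCategory.snd _ _) _ rfl ≫ F.eval X)) (by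
    simp [eval_hom])

lemma strength_snd (F : Poly I J) (K : E) (X : Over I) :
    F.strength K X ≫ (F.extension.map (prodSnd K X)).left = CartesianMonoidalCategory.snd _ _ := by
  have hb : F.strength K X ≫ F.base (prodOver K X) =
    CartesianMonoidalCategory.snd _ _ ≫ F.base X := F.toExt_base _ _ _
  refine F.extension_hom_ext (CartesianMonoidalCategory.snd _ _ ≫ F.base X) ?_ rfl ?_
  · rw [Category.assoc, F.map_base, hb]
  · rw [reindex_comp F.f _ _ _ hb (F.map_base _), Category.assoc, F.reindex_map_eval]
    refine (Category.assoc _ _ _).symm.trans ?_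
    refine (congrArg (· ≫ (prodSnd K X).left) (F.toExt_eval _ _ _)).trans ?_
    simp

lemma strength_hom (F : Poly I J) (K : E) (X : Over I) :
    F.strength K X ≫ (F.extension.obj (prodOver K X)).hom =
      CartesianMonoidalCategory.snd _ _ ≫ (F.extension.obj X).hom := by
  rw [← strength_snd, Category.assoc, Over.w]

/-- The map `⟨s, f⟩ : B ⟶ K × A` over `I`. -/
abbrev graph (F : Poly K I) : F.dom ⟶ prodOver K F.cod :=
  Over.homMk (CartesianMonoidalCategory.lift F.s F.f)

end Poly

/-- A fibrewise application of the extension `P_p` to a polynomial `K ←s− B −f→ A −t→ I`, regarded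
as a family of maps `f_k : B_k ⟶ A` over `I` indexed by `k : K`. The result is the polynomial
`K ← B⁺ → P_p(A) → J` which corresponds to the family of maps `P_p(f_k) : P_p(B_k) ⟶ P_p(A)`. In
terms of the map `⟨s, f⟩ : B ⟶ K × A` it is given by a pullback square of
`P_p(⟨s, f⟩) : P_p(B) ⟶ P_p(K × A)` and the strength `K × P_p(A) ⟶ P_p(K × A)`, with projections
`π : B⁺ ⟶ P_p(B)` and `⟨s⁺, f⁺⟩ : B⁺ ⟶ K × P_p(A)`. It is unique up to isomorphism. -/
structure FibrewiseExtension {I J K : E} (p : Poly I J) (F : Poly K I) where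
  B : E
  s : B ⟶ K
  f : B ⟶ (p.extension.obj F.cod).left
  π : Over.mk (f ≫ (p.extension.obj F.cod).hom) ⟶ p.extension.obj F.dom
  isPullback : IsPullback π.left (CartesianMonoidalCategory.lift s f)
    (p.extension.map F.graph).left (p.strength K F.cod)

namespace FibrewiseExtension

variable {I J K : E} {p : Poly I J} {F : Poly K I}

/-- The polynomial `K ← B⁺ → P_p(A) → J`. -/
abbrev obj (c : FibrewiseExtension p F) : Poly K J where
  B := c.B
  A := (p.extension.obj F.cod).left
  s := c.s
  f := c.f
  t := (p.extension.obj F.cod).hom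

/-- The fibrewise extension given by the chosen pullbacks. -/
def canonical (p : Poly I J) (F : Poly K I) : FibrewiseExtension p F where
  B := pullbackObj (p.extension.map F.graph).left (p.strength K F.cod)
  s := snd _ _ ≫ CartesianMonoidalCategory.fst _ _
  f := snd _ _ ≫ CartesianMonoidalCategory.snd _ _
  π := Over.homMk (fst (p.extension.map F.graph).left (p.strength K F.cod)) (by
    have h' := condition (f := (p.extension.map F.graph).left) (g := p.strength K F.cod)
    rw [← Over.w (p.extension.map F.graph), reassoc_of% h', Poly.strength_hom]
    exact (Category.assoc _ _ _).symm)
  isPullback := by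
    have h := ChosenPullbacksAlong.isPullback (p.extension.map F.graph).left (p.strength K F.cod)
    rwa [← CartesianMonoidalCategory.lift_comp_fst_snd (snd _ (p.strength K F.cod))] at h

instance : Nonempty (FibrewiseExtension p F) := ⟨canonical p F⟩

/-- If `K` is terminal, then the map `P_p(f) : P_p(B) ⟶ P_p(A)` is the fibrewise extension. -/
def ofTerminal (hK : Limits.IsTerminal K) (p : Poly I J) (F : Poly K I) :
    FibrewiseExtension p F where
  B := (p.extension.obj F.dom).left
  s := hK.from _
  f := (p.extension.map (Over.homMk F.f : F.dom ⟶ F.cod)).left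
  π := Over.homMk (𝟙 _) (by simp)
  isPullback := by
    have hs : ∀ X : E, IsIso (CartesianMonoidalCategory.snd K X) := fun X =>
      ⟨CartesianMonoidalCategory.lift (hK.from X) (𝟙 X),
        CartesianMonoidalCategory.hom_ext _ _ (hK.hom_ext _ _) (by simp), by simp⟩
    have h₁ : IsIso (Poly.prodSnd K F.cod) := by
      have : IsIso ((Over.forget I).map (Poly.prodSnd K F.cod)) := hs _
      exact isIso_of_reflects_iso _ (Over.forget I)
    have h₂ : IsIso (p.extension.map (Poly.prodSnd K F.cod)).left :=
      inferInstanceAs (IsIso ((p.extension ⋙ Over.forget J).map (Poly.prodSnd K F.cod)))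
    have h₃ : IsIso (p.strength K F.cod) := by
      have : IsIso (p.strength K F.cod ≫ (p.extension.map (Poly.prodSnd K F.cod)).left) := by
        rw [Poly.strength_snd]
        exact hs _
      exact IsIso.of_isIso_comp_right _ (p.extension.map (Poly.prodSnd K F.cod)).left
    have h₄ : IsIso (Over.homMk (𝟙 _) (by simp) :
        Over.mk ((p.extension.map (Over.homMk F.f : F.dom ⟶ F.cod)).left ≫
          (p.extension.obj F.cod).hom) ⟶ p.extension.obj F.dom).left :=
      inferInstanceAs (IsIso (𝟙 _))
    refine IsPullback.of_horiz_isIso ⟨?_⟩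
    rw [← cancel_mono (p.extension.map (Poly.prodSnd K F.cod)).left, Category.assoc,
      Category.assoc, Poly.strength_snd, CartesianMonoidalCategory.lift_snd, ← Over.comp_left,
      ← Functor.map_comp]
    have e : F.graph ≫ Poly.prodSnd K F.cod = Over.homMk F.f := by
      ext
      simp
    rw [e]
    exact Category.id_comp _

/-- The identification of the `A` of the fibrewise extension with `P_p(A)`. -/
def cod (c : FibrewiseExtension p F) {F' : Poly K J} (e : F' = c.obj) :
    F'.cod ⟶ p.extension.obj F.cod :=
  eqToHom (congrArg Poly.cod e)

/-- The projection of the `B` of the fibrewise extension to `P_p(B)`. -/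
def dom (c : FibrewiseExtension p F) {F' : Poly K J} (e : F' = c.obj) :
    F'.dom ⟶ p.extension.obj F.dom :=
  eqToHom (congrArg Poly.dom e) ≫ c.π

end FibrewiseExtension

namespace PolynomialPseudomonad

variable {I : E}

/-- The transformation `P_η : id ⟶ P_p`. -/
def unit (P : PolynomialPseudomonad I) (X : Over I) : X ⟶ P.p.extension.obj X :=
  Poly.extUnit X ≫ (CartHom.extension P.η).app X

/-- The transformation `P_μ : P_p ∘ P_p ⟶ P_p`. -/
def mult (P : PolynomialPseudomonad I) (X : Over I) :
    P.p.extension.obj (P.p.extension.obj X) ⟶ P.p.extension.obj X :=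
  P.p.extComp P.p X ≫ (CartHom.extension P.μ).app X

/-- `T = (T, h, m, …)` is a lift of the polynomial pseudomonad `P`, with respect to fibrewise
extensions `c F` of the polynomials `F`: the action of `T` on polynomials and on pullback squares
is the application of `P_p`, and the components of `h` and `m` are the pullback squares formed by
the components of `P_η` and `P_μ`. (A pullback square into `(c F).obj` is determined by its map to
`P_p(A)` and the map to `P_p(B)` induced by `π`.) -/
structure IsLift (P : PolynomialPseudomonad I) (c : ∀ F : Poly I I, FibrewiseExtension P.p F)
    (T : Pseudomonad (Poly I I)) : Prop where
  obj_eq (F : Poly I I) : T.T.obj F = (c F).obj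
  map_cod {F G : Poly I I} (φ : F ⟶ G) :
    CartHom.cod (T.T.map φ) ≫ (c G).cod (obj_eq G) =
      (c F).cod (obj_eq F) ≫ P.p.extension.map (CartHom.cod φ)
  map_dom {F G : Poly I I} (φ : F ⟶ G) :
    CartHom.dom (T.T.map φ) ≫ (c G).dom (obj_eq G) =
      (c F).dom (obj_eq F) ≫ P.p.extension.map (CartHom.dom φ)
  unit_cod (F : Poly I I) : CartHom.cod (T.η.app F) ≫ (c F).cod (obj_eq F) = P.unit F.cod
  unit_dom (F : Poly I I) : CartHom.dom (T.η.app F) ≫ (c F).dom (obj_eq F) = P.unit F.dom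
  mult_cod (F : Poly I I) :
    CartHom.cod (T.μ.app F) ≫ (c F).cod (obj_eq F) =
      (c (T.T.obj F)).cod (obj_eq (T.T.obj F)) ≫ P.p.extension.map ((c F).cod (obj_eq F)) ≫
        P.mult F.cod
  mult_dom (F : Poly I I) :
    CartHom.dom (T.μ.app F) ≫ (c F).dom (obj_eq F) =
      (c (T.T.obj F)).dom (obj_eq (T.T.obj F)) ≫ P.p.extension.map ((c F).dom (obj_eq F)) ≫
        P.mult F.dom

end PolynomialPseudomonad

end


end LCC

/-!
A polynomial pseudomonad acts on polynomials because every ingredient of the action is made of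
pullback squares. A cartesian morphism `H ⟶ F⁺` into a fibrewise application `F⁺` of `P_p` to `F` is
the same as a pair of maps to `P_p(A)` and `P_p(B)` over `I` that form a pullback square over the
strength (`FibrewiseExtension.homOf`, `FibrewiseExtension.cartHom_ext`). The three squares that are
needed come from three facts:

* `P_p` preserves pullbacks (`Poly.extension_map_isPullback`) and the strength is natural; this
  gives the action on pullback squares;
* `P_η` and `P_μ` are cartesian transformations (`PolynomialPseudomonad.unit_isPullback`,
  `PolynomialPseudomonad.mult_isPullback`); this uses that the comparison
  `P_G(P_F(X)) ⟶ P_{G · F}(X)` is bijective on generalized elements;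
* `P_η` and `P_μ` are compatible with the strength (`PolynomialPseudomonad.unit_strength`,
  `PolynomialPseudomonad.mult_strength`).

The 2-cells need no work: there is exactly one adjustment between parallel cartesian morphisms, so
the modifications exist and all equations between them hold. What remains for a polynomial 2-monad
are equations of 1-cells. They hold because `(P_p, P_η, P_μ)` is then a strict monad
(`mult_assoc`, `map_unit_mult`, `unit_mult` in the namespace `PolynomialPseudomonad`), which follows
from the coherence of the comparison maps with whiskering, unitors and associators.

All calculations with extensions are done on generalized elements: an element of `P_F(X)` is an
element `a` of `A` with a map from the fibre `B_a` to `X`, and `Poly.evalAt` is the value of that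
map at an element of the fibre. The coherence laws thereby become the evident equations between
values.
-/

namespace LCC

open CategoryTheory ChosenPullbacksAlong ExponentiableMorphism

/-! ### Pullback squares and cartesian morphisms -/

/-- A commutative square is a pullback if it has the universal property on generalized elements. -/
lemma isPullback_of_exists {C : Type*} [Category C] {P X Y Z : C} {a : P ⟶ X} {b : P ⟶ Y}
    {c : X ⟶ Z} {d : Y ⟶ Z} (w : a ≫ c = b ≫ d)
    (hex : ∀ {W : C} (x : W ⟶ X) (y : W ⟶ Y), x ≫ c = y ≫ d → ∃ l : W ⟶ P, l ≫ a = x ∧ l ≫ b = y)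
    (huniq : ∀ {W : C} (l l' : W ⟶ P), l ≫ a = l' ≫ a → l ≫ b = l' ≫ b → l = l') :
    IsPullback a b c d where
  w := w
  isLimit' := ⟨by
    choose l h₁ h₂ using @hex
    exact Limits.PullbackCone.IsLimit.mk w (fun s => l s.fst s.snd s.condition)
      (fun s => h₁ _ _ _) (fun s => h₂ _ _ _) (fun s m e₁ e₂ =>
        huniq _ _ (e₁.trans (h₁ _ _ _).symm) (e₂.trans (h₂ _ _ _).symm))⟩

namespace CartHom

variable {E : Type u} [Category.{v} E] {I J : E} {F G H : Poly I J}

/-- Every element of a fibre of `G` over the image of an element `a` of `F.A` comes from an element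
of the fibre of `F` over `a`. -/
lemma exists_lift (φ : CartHom F G) {W : E} (a : W ⟶ F.A)
    (d : W ⟶ G.B) (h : a ≫ φ.φ₀ = d ≫ G.f) : ∃ b : W ⟶ F.B, b ≫ φ.φ₁ = d ∧ a = b ≫ F.f :=
  ⟨φ.isPullback.lift d a h.symm, by simp, by simp⟩

lemma comp_dom (φ : CartHom F G) (ψ : CartHom G H) : (φ.comp ψ).dom = φ.dom ≫ ψ.dom := rfl

end CartHom

noncomputable section

variable {E : Type u} [Category.{v} E] [ChosenPullbacks E]
  [∀ {X Y : E} (f : X ⟶ Y), ExponentiableMorphism f]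

/-! ### Generalized elements of extensions -/

namespace Poly

variable {I J K L : E}

/-- A generalized element `m` of `P_F(X)` is a pair of an element `a` of `A` and a map from the
fibre `B_a` to `X`; this is the value of the second component at a generalized element `b` of the
fibre. -/
def evalAt (F : Poly I J) {X : Over I} {W : E} (m : W ⟶ (F.extension.obj X).left) (b : W ⟶ F.B)
    (h : m ≫ F.base X = b ≫ F.f) : W ⟶ X.left :=
  lift m b h ≫ F.eval X

lemma evalAt_congr (F : Poly I J) {X : Over I} {W : E} {m m' : W ⟶ (F.extension.obj X).left}
    {b b' : W ⟶ F.B} (h : m ≫ F.base X = b ≫ F.f) (hm : m = m') (hb : b = b') :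
    F.evalAt m b h = F.evalAt m' b' (by rw [← hm, ← hb, h]) := by
  subst hm hb
  rfl

lemma comp_evalAt (F : Poly I J) {X : Over I} {V W : E} (w : V ⟶ W)
    (m : W ⟶ (F.extension.obj X).left) (b : W ⟶ F.B) (h : m ≫ F.base X = b ≫ F.f) :
    w ≫ F.evalAt m b h = F.evalAt (w ≫ m) (w ≫ b) (by simp [h]) := by
  rw [evalAt, evalAt, ← Category.assoc]
  refine congrArg (· ≫ F.eval X) ?_
  apply ChosenPullbacksAlong.hom_ext
  · simp
  · simp

lemma evalAt_hom (F : Poly I J) {X : Over I} {W : E} (m : W ⟶ (F.extension.obj X).left)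
    (b : W ⟶ F.B) (h : m ≫ F.base X = b ≫ F.f) : F.evalAt m b h ≫ X.hom = b ≫ F.s := by
  rw [evalAt, Category.assoc, eval_hom, ← Category.assoc, lift_snd _ _ _]

/-- Extensionality for generalized elements of `P_F(X)`. -/
lemma hom_ext_evalAt (F : Poly I J) {X : Over I} {Z : E} {m m' : Z ⟶ (F.extension.obj X).left}
    (hb : m ≫ F.base X = m' ≫ F.base X)
    (he : ∀ {W : E} (w : W ⟶ Z) (b : W ⟶ F.B) (h : (w ≫ m) ≫ F.base X = b ≫ F.f)
      (h' : (w ≫ m') ≫ F.base X = b ≫ F.f), F.evalAt (w ≫ m) b h = F.evalAt (w ≫ m') b h') :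
    m = m' := by
  refine F.extension_hom_ext (m ≫ F.base X) rfl hb.symm ?_
  exact he (fst _ _) (snd _ _) (by rw [Category.assoc, condition])
    (by rw [Category.assoc, ← hb, condition])

lemma evalAt_toExt (F : Poly I J) {X : Over I} {W Z : E} (w : W ⟶ Z) (a : Z ⟶ F.A)
    (k : pullbackObj a F.f ⟶ X.left) (hk : k ≫ X.hom = snd a F.f ≫ F.s) (b : W ⟶ F.B)
    (h : (w ≫ F.toExt a k hk) ≫ F.base X = b ≫ F.f) :
    F.evalAt (w ≫ F.toExt a k hk) b h =
      lift (f := a) (g := F.f) w b (by rw [← h, Category.assoc, toExt_base]) ≫ k := by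
  refine Eq.trans ?_ (congrArg (lift w b _ ≫ ·) (F.toExt_eval a k hk))
  rw [evalAt, ← Category.assoc]
  refine congrArg (· ≫ F.eval X) ?_
  apply ChosenPullbacksAlong.hom_ext
  · simp
  · simp

lemma evalAt_map (F : Poly I J) {X Y : Over I} (g : X ⟶ Y) {W : E}
    (m : W ⟶ (F.extension.obj X).left) (b : W ⟶ F.B)
    (h : (m ≫ (F.extension.map g).left) ≫ F.base Y = b ≫ F.f) :
    F.evalAt (m ≫ (F.extension.map g).left) b h =
      F.evalAt m b (by rw [← h, Category.assoc, map_base]) ≫ g.left := by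
  rw [evalAt, evalAt, Category.assoc, ← F.reindex_map_eval g, ← Category.assoc]
  congr 1
  apply ChosenPullbacksAlong.hom_ext
  · simp
  · simp

/-- The value of `φ_X(a, k)` at the image `φ₁(b)` of `b` is `k(b)`. -/
lemma evalAt_extApp {F G : Poly I J} (φ : CartHom F G) (X : Over I) {W : E}
    (m : W ⟶ (F.extension.obj X).left) (b : W ⟶ F.B) (h : m ≫ F.base X = b ≫ F.f)
    (h' : (m ≫ φ.extApp X) ≫ G.base X = (b ≫ φ.φ₁) ≫ G.f) :
    G.evalAt (m ≫ φ.extApp X) (b ≫ φ.φ₁) h' = F.evalAt m b h := by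
  refine (G.evalAt_toExt m (F.base X ≫ φ.φ₀) (φ.pull (F.base X) ≫ F.eval X) _ _ h').trans ?_
  rw [evalAt, ← Category.assoc]
  congr 1
  apply φ.pull_hom_ext
  · simp
  · simp

/-- An element of a fibre of `G · F` is a pair of an element `d` of a fibre of `G` and an element
`b` of a fibre of `F`; the value of the image of `m` in `P_{G · F}(X)` at it is `m(d)(b)`. -/
lemma evalAt_extComp (G : Poly J K) (F : Poly I J) (X : Over I) {W : E}
    (m : W ⟶ (G.extension.obj (F.extension.obj X)).left) (n : W ⟶ (G.comp F).B)
    (h : (m ≫ (G.extComp F X).left) ≫ (G.comp F).base X = n ≫ (G.comp F).f)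
    (hG : m ≫ G.base (F.extension.obj X) =
      (n ≫ snd F.f (G.evalCod F) ≫ snd (G.base F.cod) G.f) ≫ G.f)
    (hF : G.evalAt m (n ≫ snd F.f (G.evalCod F) ≫ snd (G.base F.cod) G.f) hG ≫ F.base X =
      (n ≫ fst F.f (G.evalCod F)) ≫ F.f) :
    (G.comp F).evalAt (m ≫ (G.extComp F X).left) n h =
      F.evalAt (G.evalAt m (n ≫ snd F.f (G.evalCod F) ≫ snd (G.base F.cod) G.f) hG)
        (n ≫ fst F.f (G.evalCod F)) hF := by
  refine ((G.comp F).evalAt_toExt m (G.extCompBase F X) (G.extCompPair F X ≫ F.eval X) _ n h).trans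
    ?_
  rw [evalAt, ← Category.assoc]
  congr 1
  apply ChosenPullbacksAlong.hom_ext
  · rw [Category.assoc, extCompPair_fst, lift_fst _ _ _, evalAt, ← Category.assoc]
    congr 1
    apply ChosenPullbacksAlong.hom_ext
    · rw [Category.assoc, extCompD_fst, lift_fst _ _ _, lift_fst _ _ _]
    · rw [Category.assoc, extCompD_snd, lift_snd _ _ _, ← Category.assoc, lift_snd _ _ _]
  · rw [Category.assoc, extCompPair_snd, lift_snd _ _ _, ← Category.assoc, lift_snd _ _ _]

lemma extComp_base (G : Poly J K) (F : Poly I J) (X : Over I) :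
    (G.extComp F X).left ≫ (G.comp F).base X = (G.extension.map (F.baseOver X)).left :=
  (G.comp F).toExt_base _ _ _

/-- If `n` lies in the fibre over the image of `m`, then its `G`-component lies in the fibre over
`m`, so that `m` can be evaluated at it. -/
lemma evalAt_extComp_cond₁ (G : Poly J K) (F : Poly I J) (X : Over I) {W : E}
    {m : W ⟶ (G.extension.obj (F.extension.obj X)).left} {n : W ⟶ (G.comp F).B}
    (h : (m ≫ (G.extComp F X).left) ≫ (G.comp F).base X = n ≫ (G.comp F).f) :
    m ≫ G.base (F.extension.obj X) =
      (n ≫ snd F.f (G.evalCod F) ≫ snd (G.base F.cod) G.f) ≫ G.f := by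
  rw [Category.assoc, extComp_base] at h
  rw [← G.map_base (F.baseOver X), reassoc_of% h]
  simp only [Category.assoc, condition]

/-- If `n` lies in the fibre over the image of `m`, then its `F`-component lies in the fibre over
the value of `m` at its `G`-component. -/
lemma evalAt_extComp_cond₂ (G : Poly J K) (F : Poly I J) (X : Over I) {W : E}
    {m : W ⟶ (G.extension.obj (F.extension.obj X)).left} {n : W ⟶ (G.comp F).B}
    (h : (m ≫ (G.extComp F X).left) ≫ (G.comp F).base X = n ≫ (G.comp F).f) :
    G.evalAt m (n ≫ snd F.f (G.evalCod F) ≫ snd (G.base F.cod) G.f)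
      (G.evalAt_extComp_cond₁ F X h) ≫ F.base X =
      (n ≫ fst F.f (G.evalCod F)) ≫ F.f := by
  have e := G.evalAt_map (F.baseOver X) m
    (n ≫ snd F.f (G.evalCod F) ≫ snd (G.base F.cod) G.f) (by
      rw [Category.assoc, map_base]; exact G.evalAt_extComp_cond₁ F X h)
  refine e.symm.trans ?_
  refine Eq.trans ?_ ((congrArg (n ≫ ·) (condition (f := F.f) (g := G.evalCod F)).symm).trans
    (Category.assoc _ _ _).symm)
  change _ = n ≫ snd F.f (G.evalCod F) ≫ G.eval F.cod
  refine Eq.trans ?_ (Category.assoc _ _ _)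
  refine congrArg (· ≫ G.eval F.cod) ?_
  apply ChosenPullbacksAlong.hom_ext
  · rw [lift_fst _ _ _, ← extComp_base, ← Category.assoc, h, Category.assoc]
  · rw [lift_snd _ _ _, Category.assoc]

lemma extUnit_base (X : Over I) : (extUnit X).left ≫ (ident I).base X = X.hom :=
  (ident I).toExt_base _ _ _

lemma evalAt_extUnit (X : Over I) {W : E} (m : W ⟶ X.left) (b : W ⟶ (ident I).B)
    (h : (m ≫ (extUnit X).left) ≫ (ident I).base X = b ≫ (ident I).f) :
    (ident I).evalAt (m ≫ (extUnit X).left) b h = m :=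
  ((ident I).evalAt_toExt m X.hom (fst X.hom (𝟙 I)) condition b h).trans (lift_fst _ _ _)

end Poly

/-! ### Extensions preserve pullbacks; cartesian transformations -/

namespace Poly

variable {I J K L : E}

/-- If two generalized elements of `P_F(X)` have the same image in `P_F(Y)`, then their values have
the same image in `Y`. -/
lemma evalAt_comp_eq (F : Poly I J) {X Y : Over I} (g : X ⟶ Y) {W : E}
    {m m' : W ⟶ (F.extension.obj X).left} {b : W ⟶ F.B}
    (e : m ≫ (F.extension.map g).left = m' ≫ (F.extension.map g).left)
    (h : m ≫ F.base X = b ≫ F.f) (h' : m' ≫ F.base X = b ≫ F.f) :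
    F.evalAt m b h ≫ g.left = F.evalAt m' b h' ≫ g.left := by
  have h₁ : (m ≫ (F.extension.map g).left) ≫ F.base Y = b ≫ F.f := by
    rw [Category.assoc, map_base, h]
  rw [← F.evalAt_map g m b h₁, F.evalAt_congr h₁ e rfl, F.evalAt_map]

lemma extension_map_isPullback (F : Poly I J) {X Y Z W : Over I} {a : X ⟶ Y} {b : X ⟶ Z}
    {c : Y ⟶ W} {d : Z ⟶ W} (h : IsPullback a.left b.left c.left d.left) :
    IsPullback (F.extension.map a).left (F.extension.map b).left (F.extension.map c).left
      (F.extension.map d).left := by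
  have w : a ≫ c = b ≫ d := Over.OverMorphism.ext h.w
  refine isPullback_of_exists ?_ ?_ ?_
  · rw [← Over.comp_left, ← Over.comp_left, ← Functor.map_comp, ← Functor.map_comp, w]
  · intro V x y e
    have hb : x ≫ F.base Y = y ≫ F.base Z := by
      rw [← F.map_base c, reassoc_of% e, F.map_base]
    have hx : (fst (x ≫ F.base Y) F.f ≫ x) ≫ F.base Y = snd (x ≫ F.base Y) F.f ≫ F.f := by
      rw [Category.assoc, condition]
    have hy : (fst (x ≫ F.base Y) F.f ≫ y) ≫ F.base Z = snd (x ≫ F.base Y) F.f ≫ F.f := by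
      rw [Category.assoc, ← hb, condition]
    have hxc : ((fst (x ≫ F.base Y) F.f ≫ x) ≫ (F.extension.map c).left) ≫ F.base W =
        snd (x ≫ F.base Y) F.f ≫ F.f := by
      rw [Category.assoc, map_base, hx]
    have hk : F.evalAt _ _ hx ≫ c.left = F.evalAt _ _ hy ≫ d.left := by
      rw [← F.evalAt_map c _ _ hxc,
        F.evalAt_congr hxc (m' := (fst (x ≫ F.base Y) F.f ≫ y) ≫ (F.extension.map d).left)
          (by simp only [Category.assoc, e]) rfl, F.evalAt_map]
    have hl : h.lift _ _ hk ≫ X.hom = snd (x ≫ F.base Y) F.f ≫ F.s := by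
      rw [← Over.w a, h.lift_fst_assoc, evalAt_hom]
    -- the common shape of `x` and `y`, with the pairs of their values
    refine ⟨F.toExt (x ≫ F.base Y) (h.lift _ _ hk) hl, ?_, ?_⟩
    · refine F.hom_ext_evalAt (by rw [Category.assoc, map_base, toExt_base]) ?_
      intro V' w b' h₁ h₂
      have h₃ : w ≫ x ≫ F.base Y = b' ≫ F.f := by rw [← h₂, Category.assoc]
      rw [F.evalAt_congr h₁ (Category.assoc _ _ _).symm rfl, evalAt_map, evalAt_toExt,
        Category.assoc, h.lift_fst, comp_evalAt]
      exact F.evalAt_congr _ (by simp) (by simp)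
    · refine F.hom_ext_evalAt (by rw [Category.assoc, map_base, toExt_base, hb]) ?_
      intro V' w b' h₁ h₂
      have h₃ : w ≫ x ≫ F.base Y = b' ≫ F.f := by rw [hb, ← h₂, Category.assoc]
      rw [F.evalAt_congr h₁ (Category.assoc _ _ _).symm rfl, evalAt_map, evalAt_toExt,
        Category.assoc, h.lift_snd, comp_evalAt]
      exact F.evalAt_congr _ (by simp) (by simp)
  · intro V l l' e₁ e₂
    refine F.hom_ext_evalAt ?_ ?_
    · rw [← F.map_base a, reassoc_of% e₁]
    · intro V' w b' h₁ h₂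
      refine h.hom_ext (F.evalAt_comp_eq a ?_ h₁ h₂) (F.evalAt_comp_eq b ?_ h₁ h₂)
      · simp only [Category.assoc, e₁]
      · simp only [Category.assoc, e₂]

end Poly

namespace CartHom

variable {I J K : E} {F G H : Poly I J}

/-- An element of `P_F(X)` is the same as an element of `P_G(X)` with a lift of its shape to
`F.A`. -/
lemma extApp_isPullback (φ : CartHom F G) (X : Over I) :
    IsPullback (φ.extApp X) (F.base X) (G.base X) φ.φ₀ := by
  refine isPullback_of_exists (φ.extApp_base X) ?_ ?_
  · intro W x a e
    have h₁ : (fst a F.f ≫ x) ≫ G.base X = (snd a F.f ≫ φ.φ₁) ≫ G.f := by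
      rw [Category.assoc, e, condition_assoc, Category.assoc, φ.isPullback.w]
    refine ⟨F.toExt a (G.evalAt _ _ h₁) (by rw [G.evalAt_hom, Category.assoc, φ.w_s]), ?_,
      F.toExt_base _ _ _⟩
    refine G.hom_ext_evalAt (by rw [Category.assoc, extApp_base, F.toExt_base_assoc, e]) ?_
    intro W' w d h h'
    obtain ⟨b, rfl, hb⟩ := φ.exists_lift (w ≫ a) d (by rw [← h', Category.assoc, Category.assoc, e])
    rw [G.evalAt_congr h (Category.assoc _ _ _).symm rfl, Poly.evalAt_extApp φ X _ b
      (by rw [Category.assoc, F.toExt_base, hb]), Poly.evalAt_toExt, Poly.comp_evalAt]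
    exact G.evalAt_congr _ (by simp) (by rw [← Category.assoc, lift_snd _ _ _])
  · intro W l l' e₁ e₂
    refine F.hom_ext_evalAt e₂ ?_
    intro W' w b h h'
    have h₁ : ((w ≫ l) ≫ φ.extApp X) ≫ G.base X = (b ≫ φ.φ₁) ≫ G.f := by
      rw [Category.assoc, extApp_base, ← Category.assoc (w ≫ l), h, Category.assoc,
        Category.assoc, φ.isPullback.w]
    rw [← Poly.evalAt_extApp φ X _ b h h₁, G.evalAt_congr h₁
      (m' := (w ≫ l') ≫ φ.extApp X) (by simp only [Category.assoc, e₁]) rfl,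
      Poly.evalAt_extApp φ X _ b h']

/-- The transformation induced by a cartesian morphism is cartesian. -/
lemma extension_isPullback (φ : CartHom F G) {X Y : Over I} (g : X ⟶ Y) :
    IsPullback (φ.extension.app X).left (F.extension.map g).left (G.extension.map g).left
      (φ.extension.app Y).left := by
  have w := congrArg CommaMorphism.left (φ.extension.naturality g)
  refine IsPullback.of_bot (h₃₁ := φ.φ₀) (v₂₁ := F.base Y) (v₂₂ := G.base Y) ?_ ?_
    (φ.extApp_isPullback Y)
  · rw [F.map_base, G.map_base]
    exact φ.extApp_isPullback X
  · exact w.symm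

lemma comp_extApp (φ : CartHom F G) (ψ : CartHom G H) (X : Over I) :
    (φ.comp ψ).extApp X = φ.extApp X ≫ ψ.extApp X := by
  refine H.hom_ext_evalAt (by simp [CartHom.comp]) ?_
  intro W w d h h'
  obtain ⟨b, rfl, hb⟩ := (φ.comp ψ).exists_lift (w ≫ F.base X) d
    (by rw [← h, Category.assoc, Category.assoc, extApp_base])
  have h₁ : (w ≫ φ.extApp X) ≫ G.base X = (b ≫ φ.φ₁) ≫ G.f := by
    rw [Category.assoc, extApp_base, reassoc_of% hb, Category.assoc, φ.isPullback.w]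
  have h₂ : ((w ≫ φ.extApp X) ≫ ψ.extApp X) ≫ H.base X = ((b ≫ φ.φ₁) ≫ ψ.φ₁) ≫ H.f := by
    rw [Category.assoc, extApp_base, ← Category.assoc (w ≫ _), h₁, Category.assoc,
      Category.assoc (b ≫ _), ψ.isPullback.w]
  rw [Poly.evalAt_extApp (φ.comp ψ) X w b hb, ← Poly.evalAt_extApp φ X w b hb h₁,
    ← Poly.evalAt_extApp ψ X _ _ h₁ h₂]
  exact H.evalAt_congr _ (Category.assoc _ _ _) (Category.assoc b φ.φ₁ ψ.φ₁)

end CartHom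

namespace Poly

variable {I J K L : E}

/-- The comparison `P_G(P_F(X)) ⟶ P_{G · F}(X)` is injective on generalized elements. -/
lemma extComp_mono (G : Poly J K) (F : Poly I J) (X : Over I) {W : E}
    {m m' : W ⟶ (G.extension.obj (F.extension.obj X)).left}
    (e : m ≫ (G.extComp F X).left = m' ≫ (G.extComp F X).left) : m = m' := by
  have e₀ : m ≫ (G.extension.map (F.baseOver X)).left =
      m' ≫ (G.extension.map (F.baseOver X)).left := by
    rw [← extComp_base, reassoc_of% e]
  refine G.hom_ext_evalAt ?_ ?_
  · rw [← G.map_base (F.baseOver X), reassoc_of% e₀]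
  intro W₁ w d h h'
  have e₁ : G.evalAt (w ≫ m) d h ≫ F.base X = G.evalAt (w ≫ m') d h' ≫ F.base X :=
    G.evalAt_comp_eq (F.baseOver X) (by simp only [Category.assoc, e₀]) h h'
  refine F.hom_ext_evalAt e₁ ?_
  intro W₂ w₂ b h₂ h₂'
  have hm : (w ≫ m ≫ (G.extension.map (F.baseOver X)).left) ≫ G.base F.cod = d ≫ G.f := by
    rw [← h]
    simp only [Category.assoc, map_base]
  have hn : b ≫ F.f = (w₂ ≫ lift (f := G.base F.cod) (g := G.f)
      (w ≫ m ≫ (G.extension.map (F.baseOver X)).left) d hm) ≫ G.evalCod F := by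
    rw [← h₂, Category.assoc, Category.assoc]
    refine congrArg (w₂ ≫ ·) ?_
    refine (G.evalAt_map (F.baseOver X) (w ≫ m) d ?_).symm.trans ?_
    · rw [← hm]
      simp only [Category.assoc]
    · exact G.evalAt_congr _ (Category.assoc _ _ _) rfl
  let n : W₂ ⟶ (G.comp F).B := lift (f := F.f) (g := G.evalCod F) b _ hn
  have hnb : n ≫ fst F.f (G.evalCod F) = b := lift_fst _ _ _
  have hnd : n ≫ snd F.f (G.evalCod F) ≫ snd (G.base F.cod) G.f = w₂ ≫ d := by
    rw [← Category.assoc, lift_snd _ _ _, Category.assoc, lift_snd _ _ _]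
  have hnf : n ≫ (G.comp F).f = w₂ ≫ w ≫ m ≫ (G.extension.map (F.baseOver X)).left := by
    change n ≫ snd F.f (G.evalCod F) ≫ fst (G.base F.cod) G.f = _
    rw [← Category.assoc, lift_snd _ _ _, Category.assoc, lift_fst _ _ _]
  have key : ∀ (l : W ⟶ (G.extension.obj (F.extension.obj X)).left)
      (hl : l ≫ (G.extComp F X).left = m ≫ (G.extComp F X).left)
      (k : (w ≫ l) ≫ G.base (F.extension.obj X) = d ≫ G.f)
      (k₂ : (w₂ ≫ G.evalAt (w ≫ l) d k) ≫ F.base X = b ≫ F.f),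
      F.evalAt (w₂ ≫ G.evalAt (w ≫ l) d k) b k₂ =
        (G.comp F).evalAt ((w₂ ≫ w ≫ m) ≫ (G.extComp F X).left) n (by
          rw [hnf, Category.assoc, extComp_base]; simp only [Category.assoc]) := by
    intro l hl k k₂
    have hcond : ((w₂ ≫ w ≫ l) ≫ (G.extComp F X).left) ≫ (G.comp F).base X =
        n ≫ (G.comp F).f := by
      rw [hnf, ← extComp_base, ← reassoc_of% hl]
      simp only [Category.assoc]
    rw [(G.comp F).evalAt_congr _ (m' := (w₂ ≫ w ≫ l) ≫ (G.extComp F X).left)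
      (by simp only [Category.assoc, hl]) rfl, evalAt_extComp G F X _ _ hcond
        (G.evalAt_extComp_cond₁ F X hcond) (G.evalAt_extComp_cond₂ F X hcond)]
    refine F.evalAt_congr _ ?_ hnb.symm
    rw [comp_evalAt]
    exact G.evalAt_congr _ rfl hnd.symm
  exact (key m rfl h h₂).trans (key m' e.symm h' h₂').symm

/-- The comparison `P_G(P_F(X)) ⟶ P_{G · F}(X)` is surjective on generalized elements: `m` is
obtained from `y` by currying. -/
lemma extComp_exists_lift (G : Poly J K) (F : Poly I J) (X : Over I) {W : E}
    (y : W ⟶ ((G.comp F).extension.obj X).left) :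
    ∃ m : W ⟶ (G.extension.obj (F.extension.obj X)).left, m ≫ (G.extComp F X).left = y := by
  let a : W ⟶ (G.extension.obj F.cod).left := y ≫ (G.comp F).base X
  let c : W ⟶ G.A := a ≫ G.base F.cod
  -- the shape of the value at `d` is read off from the shape of `y`
  let a' : pullbackObj c G.f ⟶ F.A := G.evalAt (X := F.cod) (fst c G.f ≫ a) (snd c G.f)
    (by rw [Category.assoc, condition])
  have ha' : a' ≫ F.t = snd c G.f ≫ G.s := G.evalAt_hom _ _ _
  let n : pullbackObj a' F.f ⟶ (G.comp F).B := lift (f := F.f) (g := G.evalCod F) (snd a' F.f)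
    (fst a' F.f ≫ lift (fst c G.f ≫ a) (snd c G.f) (by rw [Category.assoc, condition]))
    (by rw [← condition, Category.assoc]; rfl)
  have hn : ((fst a' F.f ≫ fst c G.f) ≫ y) ≫ (G.comp F).base X = n ≫ (G.comp F).f := by
    change _ = n ≫ snd F.f (G.evalCod F) ≫ fst (G.base F.cod) G.f
    rw [← Category.assoc, lift_snd _ _ _]
    simp [a]
  let k' : pullbackObj a' F.f ⟶ X.left := (G.comp F).evalAt _ n hn
  have hk' : k' ≫ X.hom = snd a' F.f ≫ F.s := by
    refine ((G.comp F).evalAt_hom _ _ _).trans ?_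
    change n ≫ fst F.f (G.evalCod F) ≫ F.s = _
    rw [← Category.assoc, lift_fst _ _ _]
  let k : pullbackObj c G.f ⟶ (F.extension.obj X).left := F.toExt a' k' hk'
  have hk : k ≫ (F.extension.obj X).hom = snd c G.f ≫ G.s := by
    rw [← base_t, F.toExt_base_assoc, ha']
  have hb : (G.toExt c k hk ≫ (G.extComp F X).left) ≫ (G.comp F).base X =
      y ≫ (G.comp F).base X := by
    rw [Category.assoc, extComp_base]
    refine G.hom_ext_evalAt (by rw [Category.assoc, map_base, toExt_base]) ?_
    intro V w d h h'
    rw [G.evalAt_congr h (Category.assoc _ _ _).symm rfl, evalAt_map, evalAt_toExt, Category.assoc]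
    refine (congrArg (_ ≫ ·) (F.toExt_base a' k' hk')).trans ?_
    rw [comp_evalAt]
    exact G.evalAt_congr _ (by simp [a]) (by simp)
  refine ⟨G.toExt c k hk, (G.comp F).hom_ext_evalAt hb ?_⟩
  intro V w n' h h'
  have h₁ : ((w ≫ G.toExt c k hk) ≫ (G.extComp F X).left) ≫ (G.comp F).base X =
      n' ≫ (G.comp F).f := by
    rw [← h]
    simp only [Category.assoc]
  have hd := G.evalAt_extComp_cond₁ F X h₁
  have hv : G.evalAt (w ≫ G.toExt c k hk) _ hd = lift w _ (by
      rw [← hd, Category.assoc, toExt_base]) ≫ k := G.evalAt_toExt w c k hk _ _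
  have hb' := G.evalAt_extComp_cond₂ F X h₁
  rw [(G.comp F).evalAt_congr h (Category.assoc _ _ _).symm rfl, evalAt_extComp G F X _ _ h₁ hd hb',
    F.evalAt_congr hb' hv rfl, evalAt_toExt, comp_evalAt]
  refine (G.comp F).evalAt_congr _ (by simp) ?_
  apply ChosenPullbacksAlong.hom_ext
  · rw [Category.assoc, lift_fst _ _ _, lift_snd _ _ _]
  · rw [Category.assoc, lift_snd _ _ _, ← Category.assoc, lift_fst _ _ _]
    apply ChosenPullbacksAlong.hom_ext
    · rw [Category.assoc, lift_fst _ _ _, ← Category.assoc, lift_fst _ _ _]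
      simpa [a] using h'
    · rw [Category.assoc, lift_snd _ _ _, lift_snd _ _ _, Category.assoc]

end Poly

/-! ### Naturality and coherence of the comparison maps -/

namespace Poly

variable {I J K L : E}

lemma extUnit_naturality {X Y : Over I} (g : X ⟶ Y) :
    g ≫ extUnit Y = extUnit X ≫ (ident I).extension.map g := by
  apply Over.OverMorphism.ext
  refine (ident I).hom_ext_evalAt ?_ ?_
  · rw [Over.comp_left, Over.comp_left, Category.assoc, Category.assoc, map_base, extUnit_base,
      extUnit_base, Over.w]
  · intro W w b h h'
    rw [(ident I).evalAt_congr h (Category.assoc _ _ _).symm rfl, evalAt_extUnit,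
      (ident I).evalAt_congr h' (Category.assoc _ _ _).symm rfl, evalAt_map, evalAt_extUnit]

/-- Evaluating the image of `x` in `P_{i_I}(X)` at the only element of its fibre gives back `x`. -/
lemma extUnit_eval (X : Over I) :
    (extUnit X).left ≫ (identSection X).hom ≫ (ident I).eval X = 𝟙 _ := by
  rw [← Category.assoc]
  refine Eq.trans ?_ (evalAt_extUnit X (𝟙 _) X.hom (by
    rw [Category.id_comp, extUnit_base]; exact (Category.comp_id _).symm))
  rw [evalAt]
  refine congrArg (· ≫ (ident I).eval X) ?_
  apply ChosenPullbacksAlong.hom_ext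
  · simp [identSection]
  · simp [identSection, extUnit_base]

instance extUnit_isIso (X : Over I) : IsIso (extUnit X).left := by
  refine ⟨(identSection X).hom ≫ (ident I).eval X, extUnit_eval X, ?_⟩
  have e : ((identSection X).hom ≫ (ident I).eval X) ≫ X.hom = (ident I).base X := by
    rw [Category.assoc, eval_hom]
    exact (Category.assoc _ _ _).symm.trans
      ((congrArg (· ≫ 𝟙 I) (identSection_snd X)).trans (Category.comp_id _))
  refine (ident I).hom_ext_evalAt ?_ ?_
  · rw [Category.assoc, extUnit_base, e, Category.id_comp]
  · intro W w b h h'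
    rw [(ident I).evalAt_congr h (Category.assoc _ _ _).symm rfl, evalAt_extUnit, evalAt,
      ← Category.assoc]
    refine congrArg (· ≫ (ident I).eval X) ?_
    have hb : w ≫ (ident I).base X = b := by
      rw [Category.comp_id] at h'
      exact h'.trans (Category.comp_id _)
    apply ChosenPullbacksAlong.hom_ext
    · simp [identSection]
    · simp [identSection, hb]

/-- The value of `evalAt_extComp`, with the arguments replaced by equal ones. -/
lemma evalAt_extComp_eq (G : Poly J K) (F : Poly I J) (X : Over I) {W : E}
    {m : W ⟶ (G.extension.obj (F.extension.obj X)).left} {n : W ⟶ (G.comp F).B}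
    (h : (m ≫ (G.extComp F X).left) ≫ (G.comp F).base X = n ≫ (G.comp F).f)
    {d : W ⟶ G.B} {b : W ⟶ F.B} {v : W ⟶ (F.extension.obj X).left}
    (hd : n ≫ snd F.f (G.evalCod F) ≫ snd (G.base F.cod) G.f = d)
    (hb : n ≫ fst F.f (G.evalCod F) = b)
    (hv : G.evalAt m d (by rw [← hd]; exact G.evalAt_extComp_cond₁ F X h) = v) :
    ∃ h', (G.comp F).evalAt (m ≫ (G.extComp F X).left) n h = F.evalAt v b h' := by
  subst hd hb
  obtain rfl := hv
  exact ⟨G.evalAt_extComp_cond₂ F X h, evalAt_extComp _ _ _ _ _ _ _ _⟩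

lemma baseOver_naturality (F : Poly I J) {X Y : Over I} (g : X ⟶ Y) :
    F.extension.map g ≫ F.baseOver Y = F.baseOver X :=
  Over.OverMorphism.ext (F.map_base g)

lemma extComp_naturality (G : Poly J K) (F : Poly I J) {X Y : Over I} (g : X ⟶ Y) :
    G.extension.map (F.extension.map g) ≫ G.extComp F Y =
      G.extComp F X ≫ (G.comp F).extension.map g := by
  apply Over.OverMorphism.ext
  refine (G.comp F).hom_ext_evalAt ?_ ?_
  · rw [Over.comp_left, Over.comp_left, Category.assoc, Category.assoc, map_base, extComp_base,
      extComp_base, ← Over.comp_left, ← Functor.map_comp, baseOver_naturality]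
  · intro W w n h h'
    have h₁ : ((w ≫ (G.extension.map (F.extension.map g)).left) ≫ (G.extComp F Y).left) ≫
        (G.comp F).base Y = n ≫ (G.comp F).f := by
      rw [← h]; simp only [Over.comp_left, Category.assoc]
    have h₂ : (w ≫ (G.extComp F X).left) ≫ (G.comp F).base X = n ≫ (G.comp F).f := by
      rw [← h', Over.comp_left]; simp only [Category.assoc, map_base]
    obtain ⟨hv, e₁⟩ := G.evalAt_extComp_eq F X h₂ rfl rfl rfl
    obtain ⟨hv', e₂⟩ := G.evalAt_extComp_eq F Y h₁ rfl rfl (G.evalAt_map _ _ _ _)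
    refine ((G.comp F).evalAt_congr h (Category.assoc _ _ _).symm rfl).trans (e₂.trans ?_)
    refine Eq.trans ?_ ((G.comp F).evalAt_congr h' (Category.assoc _ _ _).symm rfl).symm
    refine (F.evalAt_map g _ _ hv').trans ?_
    exact (congrArg (· ≫ g.left) e₁).symm.trans ((G.comp F).evalAt_map g _ _ _).symm

/-- The comparison is natural and bijective on generalized elements, hence cartesian. -/
lemma extComp_isPullback (G : Poly J K) (F : Poly I J) {X Y : Over I} (g : X ⟶ Y) :
    IsPullback (G.extComp F X).left (G.extension.map (F.extension.map g)).left
      ((G.comp F).extension.map g).left (G.extComp F Y).left := by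
  have w := congrArg CommaMorphism.left (G.extComp_naturality F g)
  refine isPullback_of_exists w.symm ?_ ?_
  · intro W x y e
    obtain ⟨m, rfl⟩ := G.extComp_exists_lift F X x
    refine ⟨m, rfl, G.extComp_mono F Y ?_⟩
    rw [← e, Category.assoc, Category.assoc]
    exact congrArg (m ≫ ·) w
  · intro W l l' e _
    exact G.extComp_mono F X e

/-- Two maps into `P_G(X)` are equal if they are equal on the fibres of `F`, for a cartesian
morphism `φ : F ⟶ G` through which the shapes factor. -/
lemma hom_ext_evalAt_cart {F G : Poly I J} (φ : CartHom F G) {X : Over I} {Z : E}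
    {m m' : Z ⟶ (G.extension.obj X).left} (a : Z ⟶ F.A) (ha : m ≫ G.base X = a ≫ φ.φ₀)
    (ha' : m' ≫ G.base X = a ≫ φ.φ₀)
    (he : ∀ {W : E} (w : W ⟶ Z) (b : W ⟶ F.B) (_ : w ≫ a = b ≫ F.f)
      (h : (w ≫ m) ≫ G.base X = (b ≫ φ.φ₁) ≫ G.f)
      (h' : (w ≫ m') ≫ G.base X = (b ≫ φ.φ₁) ≫ G.f),
      G.evalAt (w ≫ m) (b ≫ φ.φ₁) h = G.evalAt (w ≫ m') (b ≫ φ.φ₁) h') : m = m' := by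
  refine G.hom_ext_evalAt (ha.trans ha'.symm) ?_
  intro W w d h h'
  obtain ⟨b, rfl, hb⟩ := φ.exists_lift (w ≫ a) d
    (by rw [← h, Category.assoc, Category.assoc, ha])
  exact he w b hb h h'

/-- The comparison identifies `P_{G · φ}` with `P_G(P_φ)`. -/
lemma extComp_whiskerLeft (G : Poly J K) {F F' : Poly I J} (φ : CartHom F F') (X : Over I) :
    (G.extComp F X).left ≫ (G.whiskerLeft φ).extApp X =
      (G.extension.map (φ.extension.app X)).left ≫ (G.extComp F' X).left := by
  have eb : φ.extension.app X ≫ F'.baseOver X = F.baseOver X ≫ φ.cod :=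
    Over.OverMorphism.ext (φ.extApp_base X)
  refine hom_ext_evalAt_cart (G.whiskerLeft φ) (G.extension.map (F.baseOver X)).left ?_ ?_ ?_
  · rw [Category.assoc, CartHom.extApp_base, ← Category.assoc, extComp_base]
  · rw [Category.assoc, extComp_base, ← Over.comp_left, ← Functor.map_comp, eb, Functor.map_comp,
      Over.comp_left]
    rfl
  · intro W w n hn h h'
    have h₀ : (w ≫ (G.extComp F X).left) ≫ (G.comp F).base X = n ≫ (G.comp F).f := by
      rw [Category.assoc, extComp_base, hn]
    have h₁ : ((w ≫ (G.extension.map (φ.extension.app X)).left) ≫ (G.extComp F' X).left) ≫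
        (G.comp F').base X = (n ≫ G.whiskerLeft₁ φ) ≫ (G.comp F').f := by
      refine Eq.trans ?_ h'
      simp only [Category.assoc]
    have e₁ : (n ≫ G.whiskerLeft₁ φ) ≫ fst F'.f (G.evalCod F') =
        (n ≫ fst F.f (G.evalCod F)) ≫ φ.φ₁ := by
      rw [Category.assoc, whiskerLeft₁_fst, Category.assoc]
    have e₂ : (n ≫ G.whiskerLeft₁ φ) ≫ snd F'.f (G.evalCod F') ≫ snd (G.base F'.cod) G.f =
        n ≫ snd F.f (G.evalCod F) ≫ snd (G.base F.cod) G.f := by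
      rw [Category.assoc, whiskerLeft₁, ← Category.assoc (lift _ _ _), lift_snd _ _ _,
        whiskerLeftAux, Category.assoc, reindex_snd]
    obtain ⟨hv, e₃⟩ := G.evalAt_extComp_eq F X h₀ rfl rfl rfl
    obtain ⟨hv', e₄⟩ := G.evalAt_extComp_eq F' X h₁ e₂ e₁ (G.evalAt_map _ _ _ _)
    rw [(G.comp F').evalAt_congr h (Category.assoc _ _ _).symm rfl,
      evalAt_extApp (G.whiskerLeft φ) X _ n h₀, e₃]
    refine Eq.trans ?_ ((G.comp F').evalAt_congr h₁ (Category.assoc _ _ _) rfl)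
    rw [e₄]
    exact (evalAt_extApp φ X _ _ hv _).symm

/-- The comparison identifies `P_{ψ · F}` with `P_ψ` at `P_F(X)`. -/
lemma extComp_whiskerRight {G G' : Poly J K} (ψ : CartHom G G') (F : Poly I J) (X : Over I) :
    (G.extComp F X).left ≫ (whiskerRight ψ F).extApp X =
      ψ.extApp (F.extension.obj X) ≫ (G'.extComp F X).left := by
  have eb : (G.extension.map (F.baseOver X)).left ≫ ψ.extApp F.cod =
      ψ.extApp (F.extension.obj X) ≫ (G'.extension.map (F.baseOver X)).left :=
    congrArg CommaMorphism.left (ψ.extension.naturality (F.baseOver X))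
  refine hom_ext_evalAt_cart (whiskerRight ψ F) (G.extension.map (F.baseOver X)).left ?_ ?_ ?_
  · rw [Category.assoc, CartHom.extApp_base, ← Category.assoc, extComp_base]
  · rw [Category.assoc, extComp_base, ← eb]
    rfl
  · intro W w n hn h h'
    have h₀ : (w ≫ (G.extComp F X).left) ≫ (G.comp F).base X = n ≫ (G.comp F).f := by
      rw [Category.assoc, extComp_base, hn]
    have h₁ : ((w ≫ ψ.extApp (F.extension.obj X)) ≫ (G'.extComp F X).left) ≫
        (G'.comp F).base X = (n ≫ whiskerRight₁ ψ F) ≫ (G'.comp F).f := by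
      refine Eq.trans ?_ h'
      simp only [Category.assoc]
    have e₁ : (n ≫ whiskerRight₁ ψ F) ≫ fst F.f (G'.evalCod F) = n ≫ fst F.f (G.evalCod F) := by
      rw [Category.assoc, whiskerRight₁_fst]
    have e₂ : (n ≫ whiskerRight₁ ψ F) ≫ snd F.f (G'.evalCod F) ≫ snd (G'.base F.cod) G'.f =
        (n ≫ snd F.f (G.evalCod F) ≫ snd (G.base F.cod) G.f) ≫ ψ.φ₁ := by
      rw [Category.assoc, whiskerRight₁, ← Category.assoc (lift _ _ _), lift_snd _ _ _,
        whiskerRightAux, Category.assoc, lift_snd _ _ _]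
      simp only [Category.assoc]
    obtain ⟨hv, e₃⟩ := G.evalAt_extComp_eq F X h₀ rfl rfl rfl
    obtain ⟨hv', e₄⟩ := G'.evalAt_extComp_eq F X h₁ e₂ e₁
      (evalAt_extApp ψ _ w _ (G.evalAt_extComp_cond₁ F X h₀) _)
    rw [(G'.comp F).evalAt_congr h (Category.assoc _ _ _).symm rfl,
      evalAt_extApp (whiskerRight ψ F) X _ n h₀, e₃, ← e₄]
    exact (G'.comp F).evalAt_congr h₁ (Category.assoc _ _ _) rfl

/-- The unit law of the comparison for `i_J · F`. -/
lemma extComp_leftUnit (F : Poly I J) (X : Over I) :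
    (extUnit (F.extension.obj X)).left ≫ ((ident J).extComp F X).left ≫ F.leftUnit.extApp X =
      𝟙 _ := by
  have ha : F.base X = ((extUnit (F.extension.obj X)).left ≫ ((ident J).extComp F X).left ≫
      ((ident J).comp F).base X) ≫ F.leftUnit.φ₀ := by
    have e := congrArg CommaMorphism.left (extUnit_naturality (F.baseOver X))
    rw [extComp_base]
    refine Eq.trans ?_ (congrArg (· ≫ F.leftUnit.φ₀) e)
    refine Eq.trans ?_ (Category.assoc _ _ _).symm
    refine Eq.trans ?_ (congrArg (F.base X ≫ ·) (extUnit_eval F.cod)).symm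
    exact (Category.comp_id _).symm
  refine hom_ext_evalAt_cart F.leftUnit _ ?_ ((Category.id_comp _).trans ha) ?_
  · simp only [Category.assoc, CartHom.extApp_base]
  · intro W w n hn h h'
    have h₀ : ((w ≫ (extUnit (F.extension.obj X)).left) ≫ ((ident J).extComp F X).left) ≫
        ((ident J).comp F).base X = n ≫ ((ident J).comp F).f := by
      rw [← hn]; simp only [Category.assoc]
    obtain ⟨hv, e⟩ := (ident J).evalAt_extComp_eq F X h₀ rfl rfl
      (evalAt_extUnit _ w _ _)
    have h₁ : (((w ≫ (extUnit (F.extension.obj X)).left) ≫ ((ident J).extComp F X).left) ≫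
        F.leftUnit.extApp X) ≫ F.base X = (n ≫ F.leftUnit.φ₁) ≫ F.f := by
      rw [← h]; simp only [Category.assoc]
    rw [F.evalAt_congr h' (Category.comp_id w) rfl,
      F.evalAt_congr h (m' := ((w ≫ (extUnit (F.extension.obj X)).left) ≫
        ((ident J).extComp F X).left) ≫ F.leftUnit.extApp X) (by simp only [Category.assoc]) rfl,
      evalAt_extApp F.leftUnit X _ n h₀, e]
    rfl

/-- The unit law of the comparison for `F · i_I`. -/
lemma extComp_rightUnit (F : Poly I J) (X : Over I) :
    (F.extension.map (extUnit X)).left ≫ (F.extComp (ident I) X).left ≫ F.rightUnit.extApp X =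
      𝟙 _ := by
  have ha : F.base X = ((F.extension.map (extUnit X)).left ≫ (F.extComp (ident I) X).left ≫
      (F.comp (ident I)).base X) ≫ F.rightUnit.φ₀ := by
    rw [extComp_base]
    change _ = (_ ≫ _) ≫ F.base (ident I).cod
    rw [Category.assoc, map_base, map_base]
  refine hom_ext_evalAt_cart F.rightUnit _ ?_ ((Category.id_comp _).trans ha) ?_
  · simp only [Category.assoc, CartHom.extApp_base]
  · intro W w n hn h h'
    have h₀ : ((w ≫ (F.extension.map (extUnit X)).left) ≫ (F.extComp (ident I) X).left) ≫
        (F.comp (ident I)).base X = n ≫ (F.comp (ident I)).f := by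
      rw [← hn]; simp only [Category.assoc]
    obtain ⟨hv, e⟩ := F.evalAt_extComp_eq (ident I) X h₀ rfl rfl
      (F.evalAt_map (extUnit X) w _ _)
    rw [F.evalAt_congr h' (Category.comp_id w) rfl,
      F.evalAt_congr h (m' := ((w ≫ (F.extension.map (extUnit X)).left) ≫
        (F.extComp (ident I) X).left) ≫ F.rightUnit.extApp X) (by simp only [Category.assoc]) rfl,
      evalAt_extApp F.rightUnit X _ n h₀, e, evalAt_extUnit]
    rfl

/-- The associativity law of the comparison: both composites send an element of `P_H(P_G(P_F(X)))`
to the element whose value at `(e, d, b)` is obtained by evaluating at `e`, `d` and `b` in turn. -/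
lemma extComp_assocInv (H : Poly K L) (G : Poly J K) (F : Poly I J) (X : Over I) :
    (H.extension.map (G.extComp F X)).left ≫ (H.extComp (G.comp F) X).left ≫
        (H.assocInv G F).extApp X =
      (H.extComp G (F.extension.obj X)).left ≫ ((H.comp G).extComp F X).left := by
  have eb : G.extComp F X ≫ (G.comp F).baseOver X = G.extension.map (F.baseOver X) :=
    Over.OverMorphism.ext (G.extComp_base F X)
  have ea : (H.extension.map (G.extComp F X)).left ≫ (H.extComp (G.comp F) X).left ≫
      (H.comp (G.comp F)).base X = (H.extension.map (G.extension.map (F.baseOver X))).left := by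
    rw [extComp_base, ← Over.comp_left, ← Functor.map_comp, eb]
  refine hom_ext_evalAt_cart (H.assocInv G F)
    (H.extension.map (G.extension.map (F.baseOver X))).left ?_ ?_ ?_
  · rw [← ea]
    simp only [Category.assoc, CartHom.extApp_base]
  · rw [Category.assoc, extComp_base]
    exact (congrArg CommaMorphism.left (H.extComp_naturality G (F.baseOver X))).symm
  · intro W w n hn h h'
    have h₀ : ((w ≫ (H.extension.map (G.extComp F X)).left) ≫ (H.extComp (G.comp F) X).left) ≫
        (H.comp (G.comp F)).base X = n ≫ (H.comp (G.comp F)).f := by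
      rw [← hn, ← ea]; simp only [Category.assoc]
    obtain ⟨hv, e⟩ := H.evalAt_extComp_eq (G.comp F) X h₀ rfl rfl
      (H.evalAt_map (G.extComp F X) w _ _)
    obtain ⟨hv', e'⟩ := G.evalAt_extComp_eq F X hv rfl rfl rfl
    have e₁ : (n ≫ H.assocInv₁ G F) ≫ fst F.f ((H.comp G).evalCod F) =
        (n ≫ fst (G.comp F).f (H.evalCod (G.comp F))) ≫ fst F.f (G.evalCod F) := by
      rw [Category.assoc, assocInv₁, lift_fst _ _ _, Category.assoc]
    have e₂ : (n ≫ H.assocInv₁ G F) ≫ snd F.f ((H.comp G).evalCod F) ≫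
        snd ((H.comp G).base F.cod) (H.comp G).f = n ≫ H.assocN G F := by
      rw [Category.assoc, assocInv₁, ← Category.assoc (lift _ _ _), lift_snd _ _ _, Category.assoc,
        assocInvFib, reindex_snd]
      exact congrArg (n ≫ ·) (H.assocS_N G F)
    have e₃ : (n ≫ H.assocN G F) ≫ fst G.f (H.evalCod G) =
        (n ≫ fst (G.comp F).f (H.evalCod (G.comp F))) ≫ snd F.f (G.evalCod F) ≫
          snd (G.base F.cod) G.f := by
      rw [Category.assoc, assocN_fst, Category.assoc]
    have e₄ : (n ≫ H.assocN G F) ≫ snd G.f (H.evalCod G) ≫ snd (H.base G.cod) H.f =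
        n ≫ snd (G.comp F).f (H.evalCod (G.comp F)) ≫ snd (H.base (G.comp F).cod) H.f := by
      rw [Category.assoc, ← Category.assoc (H.assocN G F), assocN_snd, Category.assoc, extCompFib,
        reindex_snd]
      rfl
    have h₁ : ((w ≫ (H.extComp G (F.extension.obj X)).left) ≫ ((H.comp G).extComp F X).left) ≫
        ((H.comp G).comp F).base X = (n ≫ H.assocInv₁ G F) ≫ ((H.comp G).comp F).f := by
      refine Eq.trans ?_ h'
      simp only [Category.assoc]
    have h₂ := (H.comp G).evalAt_extComp_cond₁ F X h₁
    rw [e₂] at h₂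
    obtain ⟨hu, k⟩ := H.evalAt_extComp_eq G (F.extension.obj X) h₂ e₄ e₃ rfl
    obtain ⟨hu', k'⟩ := (H.comp G).evalAt_extComp_eq F X h₁ e₂ e₁ k
    rw [((H.comp G).comp F).evalAt_congr h (m' := ((w ≫ (H.extension.map (G.extComp F X)).left) ≫
        (H.extComp (G.comp F) X).left) ≫ (H.assocInv G F).extApp X)
        (by simp only [Category.assoc]) rfl,
      evalAt_extApp (H.assocInv G F) X _ n h₀, e, e', ← k']
    exact ((H.comp G).comp F).evalAt_congr _ (Category.assoc _ _ _) rfl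

end Poly

/-! ### The monad structure on the extension -/

namespace PolynomialPseudomonad

variable {I : E} (P : PolynomialPseudomonad I)

lemma unit_naturality {X Y : Over I} (g : X ⟶ Y) :
    g ≫ P.unit Y = P.unit X ≫ P.p.extension.map g := by
  rw [unit, unit, ← Category.assoc, Poly.extUnit_naturality, Category.assoc, Category.assoc,
    (CartHom.extension P.η).naturality]

lemma mult_naturality {X Y : Over I} (g : X ⟶ Y) :
    P.p.extension.map (P.p.extension.map g) ≫ P.mult Y = P.mult X ≫ P.p.extension.map g := by
  rw [mult, mult, ← Category.assoc, Poly.extComp_naturality, Category.assoc, Category.assoc,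
    (CartHom.extension P.μ).naturality]

/-- `P_η` is a cartesian transformation. -/
lemma unit_isPullback {X Y : Over I} (g : X ⟶ Y) :
    IsPullback (P.unit X).left g.left (P.p.extension.map g).left (P.unit Y).left := by
  have h : IsPullback (Poly.extUnit X).left g.left ((Poly.ident I).extension.map g).left
      (Poly.extUnit Y).left :=
    IsPullback.of_horiz_isIso ⟨(congrArg CommaMorphism.left (Poly.extUnit_naturality g)).symm⟩
  exact h.paste_horiz (CartHom.extension_isPullback P.η g)

/-- `P_μ` is a cartesian transformation. -/
lemma mult_isPullback {X Y : Over I} (g : X ⟶ Y) :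
    IsPullback (P.mult X).left (P.p.extension.map (P.p.extension.map g)).left
      (P.p.extension.map g).left (P.mult Y).left :=
  (Poly.extComp_isPullback P.p P.p g).paste_horiz (CartHom.extension_isPullback P.μ g)

lemma mult_assoc (h : P.IsTwoMonad) (X : Over I) :
    P.p.extension.map (P.mult X) ≫ P.mult X = P.mult (P.p.extension.obj X) ≫ P.mult X := by
  obtain ⟨e, -⟩ := h.1
  have e' : CartHom.comp (P.p.whiskerLeft P.μ) P.μ =
    CartHom.comp (P.p.assocInv P.p P.p) (CartHom.comp (Poly.whiskerRight P.μ P.p) P.μ) := e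
  have e₁ : (P.p.whiskerLeft P.μ).extApp X ≫ CartHom.extApp P.μ X =
      (P.p.assocInv P.p P.p).extApp X ≫ (Poly.whiskerRight P.μ P.p).extApp X ≫
        CartHom.extApp P.μ X := by
    rw [← CartHom.comp_extApp, e', CartHom.comp_extApp, CartHom.comp_extApp]
  have e₂ := Poly.extComp_whiskerLeft P.p P.μ X
  have e₃ := Poly.extComp_whiskerRight P.μ P.p X
  have e₄ := Poly.extComp_assocInv P.p P.p P.p X
  apply Over.OverMorphism.ext
  rw [mult, Functor.map_comp]
  simp only [Over.comp_left, Category.assoc]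
  change _ = ((P.p.extComp P.p (P.p.extension.obj X)).left ≫
    CartHom.extApp P.μ (P.p.extension.obj X)) ≫ (P.p.extComp P.p X).left ≫ CartHom.extApp P.μ X
  rw [Category.assoc, ← reassoc_of% e₃, ← reassoc_of% e₄, ← e₁, reassoc_of% e₂]
  rfl

lemma map_unit_mult (h : P.IsTwoMonad) (X : Over I) :
    P.p.extension.map (P.unit X) ≫ P.mult X = 𝟙 _ := by
  obtain ⟨e, -⟩ := h.2.1
  have e' : CartHom.comp (P.p.whiskerLeft P.η) P.μ = P.p.rightUnit := e
  apply Over.OverMorphism.ext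
  have e₂ := Poly.extComp_whiskerLeft P.p P.η X
  have e₃ := Poly.extComp_rightUnit P.p X
  rw [← e', CartHom.comp_extApp, reassoc_of% e₂] at e₃
  rw [unit, Functor.map_comp]
  simp only [Over.comp_left, Category.assoc]
  exact e₃

lemma unit_mult (h : P.IsTwoMonad) (X : Over I) :
    P.unit (P.p.extension.obj X) ≫ P.mult X = 𝟙 _ := by
  obtain ⟨e, -⟩ := h.2.2
  have e' : CartHom.comp (Poly.whiskerRight P.η P.p) P.μ = P.p.leftUnit := e
  apply Over.OverMorphism.ext
  have e₂ := Poly.extComp_whiskerRight P.η P.p X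
  have e₃ := Poly.extComp_leftUnit P.p X
  rw [← e', CartHom.comp_extApp, reassoc_of% e₂] at e₃
  rw [unit]
  simp only [Over.comp_left, Category.assoc]
  exact e₃

end PolynomialPseudomonad

end

noncomputable section

open scoped MonoidalCategory

variable {E : Type u} [Category.{v} E] [CartesianMonoidalCategory E]

/-! ### Pullback squares of products and graphs -/

lemma isPullback_whiskerLeft_snd (K : E) {X Y : E} (u : X ⟶ Y) :
    IsPullback (K ◁ u) (CartesianMonoidalCategory.snd K X) (CartesianMonoidalCategory.snd K Y)
      u := by
  refine isPullback_of_exists (by simp) ?_ ?_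
  · intro W x y e
    refine ⟨CartesianMonoidalCategory.lift (x ≫ CartesianMonoidalCategory.fst _ _) y, ?_, by simp⟩
    apply CartesianMonoidalCategory.hom_ext <;> simp [e]
  · intro W l l' e₁ e₂
    apply CartesianMonoidalCategory.hom_ext
    · simpa using congrArg (· ≫ CartesianMonoidalCategory.fst _ _) e₁
    · exact e₂

/-- For a pullback square `φ`, the square formed by the graphs `⟨s, f⟩` is a pullback. -/
lemma CartHom.graph_isPullback {K I : E} {F G : Poly K I} (φ : CartHom F G) :
    IsPullback φ.φ₁ (CartesianMonoidalCategory.lift F.s F.f)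
      (CartesianMonoidalCategory.lift G.s G.f) (K ◁ φ.φ₀) := by
  refine IsPullback.of_bot (h₃₁ := φ.φ₀) (v₂₁ := CartesianMonoidalCategory.snd _ _)
    (v₂₂ := CartesianMonoidalCategory.snd _ _) ?_ ?_ (isPullback_whiskerLeft_snd K φ.φ₀)
  · simpa using φ.isPullback
  · apply CartesianMonoidalCategory.hom_ext
    · simp [φ.w_s]
    · simp [φ.isPullback.w]

variable [ChosenPullbacks E] [∀ {X Y : E} (f : X ⟶ Y), ExponentiableMorphism f]

/-! ### Compatibility of the strength with the structure of extensions -/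

namespace Poly

variable {I J L : E}

lemma strength_base (F : Poly I J) (K : E) (X : Over I) :
    F.strength K X ≫ F.base (prodOver K X) = CartesianMonoidalCategory.snd _ _ ≫ F.base X :=
  F.toExt_base _ _ _

lemma evalAt_strength (F : Poly I J) (K : E) (X : Over I) {W : E}
    (m : W ⟶ K ⊗ (F.extension.obj X).left) (b : W ⟶ F.B)
    (h : (m ≫ F.strength K X) ≫ F.base (prodOver K X) = b ≫ F.f)
    (h' : (m ≫ CartesianMonoidalCategory.snd _ _) ≫ F.base X = b ≫ F.f) :
    F.evalAt (m ≫ F.strength K X) b h =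
      CartesianMonoidalCategory.lift (m ≫ CartesianMonoidalCategory.fst _ _)
        (F.evalAt (m ≫ CartesianMonoidalCategory.snd _ _) b h') := by
  refine (F.evalAt_toExt _ _ _ _ _ h).trans ?_
  rw [CartesianMonoidalCategory.comp_lift, ← Category.assoc, lift_fst _ _ _]
  congr 1
  rw [evalAt, ← Category.assoc]
  refine congrArg (· ≫ F.eval X) ?_
  apply ChosenPullbacksAlong.hom_ext
  · simp
  · simp

/-- The map `K × g : K × X ⟶ K × Y` over `I`. -/
abbrev prodMap (K : E) {X Y : Over I} (g : X ⟶ Y) : prodOver K X ⟶ prodOver K Y :=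
  Over.homMk (K ◁ g.left) (by simp)

/-- The strength as a map over `J`. -/
abbrev strengthOver (F : Poly I J) (K : E) (X : Over I) :
    prodOver K (F.extension.obj X) ⟶ F.extension.obj (prodOver K X) :=
  Over.homMk (F.strength K X) (F.strength_hom K X)

lemma strength_naturality (F : Poly I J) (K : E) {X Y : Over I} (g : X ⟶ Y) :
    K ◁ (F.extension.map g).left ≫ F.strength K Y =
      F.strength K X ≫ (F.extension.map (prodMap K g)).left := by
  refine F.hom_ext_evalAt ?_ ?_
  · rw [Category.assoc, Category.assoc, map_base, strength_base, strength_base,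
      CartesianMonoidalCategory.whiskerLeft_snd_assoc, map_base]
  · intro W w b h h'
    have h₁ : (w ≫ CartesianMonoidalCategory.snd _ _) ≫ F.base X = b ≫ F.f := by
      rw [← h', Category.assoc, Category.assoc, Category.assoc, map_base, strength_base]
    have e : (w ≫ K ◁ (F.extension.map g).left) ≫ CartesianMonoidalCategory.snd _ _ =
        (w ≫ CartesianMonoidalCategory.snd _ _) ≫ (F.extension.map g).left := by simp
    have h₂ : ((w ≫ CartesianMonoidalCategory.snd _ _) ≫ (F.extension.map g).left) ≫ F.base Y =
        b ≫ F.f := by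
      rw [Category.assoc, map_base, h₁]
    rw [F.evalAt_congr h (Category.assoc _ _ _).symm rfl,
      F.evalAt_strength K Y _ b _ (by rw [e, h₂]),
      F.evalAt_congr _ e rfl, F.evalAt_map g _ b h₂,
      F.evalAt_congr h' (Category.assoc _ _ _).symm rfl, F.evalAt_map,
      F.evalAt_strength K X w b _ h₁]
    apply CartesianMonoidalCategory.hom_ext <;> simp

lemma strength_extApp {F G : Poly I J} (φ : CartHom F G) (K : E) (X : Over I) :
    K ◁ φ.extApp X ≫ G.strength K X = F.strength K X ≫ φ.extApp (prodOver K X) := by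
  have ha : (K ◁ φ.extApp X ≫ G.strength K X) ≫ G.base (prodOver K X) =
      (CartesianMonoidalCategory.snd _ _ ≫ F.base X) ≫ φ.φ₀ := by
    rw [Category.assoc, strength_base, CartesianMonoidalCategory.whiskerLeft_snd_assoc,
      φ.extApp_base, Category.assoc]
  refine hom_ext_evalAt_cart φ (CartesianMonoidalCategory.snd _ _ ≫ F.base X) ha ?_ ?_
  · rw [Category.assoc, φ.extApp_base, ← Category.assoc, strength_base]
  · intro W w b hb h h'
    have h₁ : (w ≫ CartesianMonoidalCategory.snd _ _) ≫ F.base X = b ≫ F.f := by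
      rw [← hb, Category.assoc]
    have h₂ : (w ≫ F.strength K X) ≫ F.base (prodOver K X) = b ≫ F.f := by
      rw [Category.assoc, strength_base, hb]
    have e : (w ≫ K ◁ φ.extApp X) ≫ CartesianMonoidalCategory.snd _ _ =
        (w ≫ CartesianMonoidalCategory.snd _ _) ≫ φ.extApp X := by simp
    have h₃ : ((w ≫ CartesianMonoidalCategory.snd _ _) ≫ φ.extApp X) ≫ G.base X =
        (b ≫ φ.φ₁) ≫ G.f := by
      rw [Category.assoc, φ.extApp_base, ← Category.assoc, h₁, Category.assoc, Category.assoc,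
        φ.isPullback.w]
    rw [G.evalAt_congr h (Category.assoc _ _ _).symm rfl,
      G.evalAt_strength K X _ _ _ (by rw [e, h₃]), G.evalAt_congr _ e rfl,
      evalAt_extApp φ X _ b h₁ h₃, G.evalAt_congr h' (Category.assoc _ _ _).symm rfl,
      evalAt_extApp φ _ _ b h₂, F.evalAt_strength K X w b _ h₁]
    simp

lemma strength_extUnit (K : E) (X : Over I) :
    K ◁ (extUnit X).left ≫ (ident I).strength K X = (extUnit (prodOver K X)).left := by
  refine (ident I).hom_ext_evalAt ?_ ?_
  · rw [Category.assoc, strength_base, CartesianMonoidalCategory.whiskerLeft_snd_assoc,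
      extUnit_base, extUnit_base]
    rfl
  · intro W w b h h'
    have e : (w ≫ K ◁ (extUnit X).left) ≫ CartesianMonoidalCategory.snd _ _ =
        (w ≫ CartesianMonoidalCategory.snd _ _) ≫ (extUnit X).left := by simp
    have h₁ : ((w ≫ CartesianMonoidalCategory.snd _ _) ≫ (extUnit X).left) ≫ (ident I).base X =
        b ≫ (ident I).f := by
      rw [← h', Category.assoc, Category.assoc, Category.assoc, extUnit_base, extUnit_base]
      rfl
    rw [evalAt_extUnit, (ident I).evalAt_congr h (Category.assoc _ _ _).symm rfl,
      (ident I).evalAt_strength K X _ _ _ (by rw [e, h₁]), (ident I).evalAt_congr _ e rfl,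
      evalAt_extUnit]
    apply CartesianMonoidalCategory.hom_ext <;> simp

/-- The strength of a composite is the composite of the strengths. -/
lemma strength_extComp (G : Poly J L) (F : Poly I J) (K : E) (X : Over I) :
    K ◁ (G.extComp F X).left ≫ (G.comp F).strength K X =
      G.strength K (F.extension.obj X) ≫ (G.extension.map (F.strengthOver K X)).left ≫
        (G.extComp F (prodOver K X)).left := by
  have eb : F.strengthOver K X ≫ F.baseOver (prodOver K X) =
      prodSnd K (F.extension.obj X) ≫ F.baseOver X :=
    Over.OverMorphism.ext (F.strength_base K X)
  refine (G.comp F).hom_ext_evalAt ?_ ?_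
  · rw [Category.assoc, strength_base, CartesianMonoidalCategory.whiskerLeft_snd_assoc,
      Category.assoc, Category.assoc, extComp_base, extComp_base, ← Over.comp_left,
      ← Functor.map_comp, eb, Functor.map_comp, Over.comp_left, ← Category.assoc (G.strength _ _),
      strength_snd]
  · intro W w n h h'
    have e : (w ≫ K ◁ (G.extComp F X).left) ≫ CartesianMonoidalCategory.snd _ _ =
        (w ≫ CartesianMonoidalCategory.snd _ _) ≫ (G.extComp F X).left := by simp
    have h₁ : ((w ≫ CartesianMonoidalCategory.snd _ _) ≫ (G.extComp F X).left) ≫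
        (G.comp F).base X = n ≫ (G.comp F).f := by
      rw [← h]
      simp only [Category.assoc, strength_base, CartesianMonoidalCategory.whiskerLeft_snd_assoc]
    have h₂ : ((w ≫ G.strength K (F.extension.obj X) ≫
        (G.extension.map (F.strengthOver K X)).left) ≫ (G.extComp F (prodOver K X)).left) ≫
        (G.comp F).base (prodOver K X) = n ≫ (G.comp F).f := by
      rw [← h']
      simp only [Category.assoc]
    obtain ⟨hv, e₁⟩ := G.evalAt_extComp_eq F X h₁ rfl rfl rfl
    have hd := G.evalAt_extComp_cond₁ F X h₁
    have hd' : (w ≫ G.strength K (F.extension.obj X)) ≫ G.base _ =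
        (n ≫ snd F.f (G.evalCod F) ≫ snd (G.base F.cod) G.f) ≫ G.f := by
      rw [← hd, Category.assoc, strength_base, Category.assoc]
    have hd'' : ((w ≫ G.strength K (F.extension.obj X)) ≫
        (G.extension.map (F.strengthOver K X)).left) ≫ G.base _ =
        (n ≫ snd F.f (G.evalCod F) ≫ snd (G.base F.cod) G.f) ≫ G.f := by
      rw [← hd', Category.assoc, map_base]
    obtain ⟨hv', e₂⟩ := G.evalAt_extComp_eq F (prodOver K X) h₂ rfl rfl
      ((G.evalAt_congr _ (Category.assoc _ _ _).symm rfl).trans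
        ((G.evalAt_map (F.strengthOver K X) _ _ hd'').trans
          (congrArg (· ≫ F.strength K X) (G.evalAt_strength K _ w _ hd' hd))))
    have c : ((CartesianMonoidalCategory.lift (w ≫ CartesianMonoidalCategory.fst _ _)
        (G.evalAt (w ≫ CartesianMonoidalCategory.snd _ _) _ hd)) ≫
          CartesianMonoidalCategory.snd _ _) ≫ F.base X =
        (n ≫ fst F.f (G.evalCod F)) ≫ F.f := by
      rw [CartesianMonoidalCategory.lift_snd, hv]
    have e₃ := F.evalAt_strength K X _ _ hv' c
    refine ((G.comp F).evalAt_congr h (Category.assoc _ _ _).symm rfl).trans ?_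
    refine ((G.comp F).evalAt_strength K X _ n _ (by rw [e, h₁])).trans ?_
    refine Eq.trans ?_ ((G.comp F).evalAt_congr h₂ (by simp only [Category.assoc]) rfl)
    rw [e₂, e₃, (G.comp F).evalAt_congr _ e rfl, e₁]
    apply CartesianMonoidalCategory.hom_ext
    · simp
    · simp only [CartesianMonoidalCategory.lift_snd]

end Poly

namespace PolynomialPseudomonad

variable {I : E} (P : PolynomialPseudomonad I)

lemma unit_strength (K : E) (X : Over I) :
    K ◁ (P.unit X).left ≫ P.p.strength K X = (P.unit (Poly.prodOver K X)).left := by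
  change K ◁ ((Poly.extUnit X).left ≫ CartHom.extApp P.η X) ≫ _ =
    (Poly.extUnit (Poly.prodOver K X)).left ≫ CartHom.extApp P.η _
  rw [MonoidalCategory.whiskerLeft_comp, Category.assoc, Poly.strength_extApp, ← Category.assoc,
    Poly.strength_extUnit]

lemma mult_strength (K : E) (X : Over I) :
    K ◁ (P.mult X).left ≫ P.p.strength K X =
      P.p.strength K (P.p.extension.obj X) ≫ (P.p.extension.map (P.p.strengthOver K X)).left ≫
        (P.mult (Poly.prodOver K X)).left := by
  change K ◁ ((P.p.extComp P.p X).left ≫ CartHom.extApp P.μ X) ≫ _ =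
    _ ≫ _ ≫ (P.p.extComp P.p (Poly.prodOver K X)).left ≫ CartHom.extApp P.μ _
  rw [MonoidalCategory.whiskerLeft_comp, Category.assoc, Poly.strength_extApp, ← Category.assoc,
    Poly.strength_extComp]
  simp only [Category.assoc]

end PolynomialPseudomonad

/-! ### Cartesian morphisms into a fibrewise extension -/

namespace FibrewiseExtension

variable {I J K : E} {p : Poly I J} {F : Poly K I}

/-- The cartesian morphism into a fibrewise extension that is given by maps `u` to `P_p(A)` and `w`
to `P_p(B)` which form a pullback square over the strength. -/
def homOf (c : FibrewiseExtension p F) {H : Poly K J} (u : H.cod ⟶ p.extension.obj F.cod)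
    (w : H.dom ⟶ p.extension.obj F.dom)
    (h : IsPullback w.left (CartesianMonoidalCategory.lift H.s H.f) (p.extension.map F.graph).left
      (K ◁ u.left ≫ p.strength K F.cod)) : CartHom H c.obj :=
  -- the square over `K × P_p(A)` is a pullback by cancellation; pasting with the square of the
  -- projections `K × P_p(A) ⟶ P_p(A)` gives the square of the polynomials
  let l := c.isPullback.lift w.left (CartesianMonoidalCategory.lift H.s H.f ≫ K ◁ u.left)
    (by rw [h.w, Category.assoc])
  have hl₁ : l ≫ c.π.left = w.left := c.isPullback.lift_fst _ _ _
  have hl₂ : l ≫ CartesianMonoidalCategory.lift c.s c.f =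
    CartesianMonoidalCategory.lift H.s H.f ≫ K ◁ u.left := c.isPullback.lift_snd _ _ _
  { φ₀ := u.left
    φ₁ := l
    isPullback := by
      rw [← hl₁] at h
      have h' := (IsPullback.of_right h hl₂ c.isPullback).paste_vert
        (isPullback_whiskerLeft_snd K u.left)
      simpa using h'
    w_s := by simpa using congrArg (· ≫ CartesianMonoidalCategory.fst _ _) hl₂
    w_t := Over.w u }

lemma homOf_dom (c : FibrewiseExtension p F) {H : Poly K J} (u : H.cod ⟶ p.extension.obj F.cod)
    (w : H.dom ⟶ p.extension.obj F.dom)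
    (h : IsPullback w.left (CartesianMonoidalCategory.lift H.s H.f) (p.extension.map F.graph).left
      (K ◁ u.left ≫ p.strength K F.cod)) : (c.homOf u w h).dom ≫ c.π = w :=
  Over.OverMorphism.ext (c.isPullback.lift_fst _ _ _)

/-- A cartesian morphism into a fibrewise extension is determined by its maps to `P_p(A)` and
`P_p(B)`. -/
lemma cartHom_ext (c : FibrewiseExtension p F) {H : Poly K J} {φ ψ : CartHom H c.obj}
    (h₀ : φ.cod = ψ.cod) (h₁ : φ.dom ≫ c.π = ψ.dom ≫ c.π) : φ = ψ := by
  have h₀' : φ.φ₀ = ψ.φ₀ := congrArg CommaMorphism.left h₀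
  refine CartHom.ext h₀' (c.isPullback.hom_ext (congrArg CommaMorphism.left h₁) ?_)
  apply CartesianMonoidalCategory.hom_ext
  · simpa using φ.w_s.trans ψ.w_s.symm
  · have e := φ.isPullback.w.trans (congrArg (H.f ≫ ·) h₀')
    simpa using e.trans ψ.isPullback.w.symm

/-- The action of `P_p` on pullback squares. -/
def mapHom {F G : Poly K I} (c : FibrewiseExtension p F) (d : FibrewiseExtension p G)
    (φ : CartHom F G) : CartHom c.obj d.obj :=
  d.homOf (p.extension.map φ.cod) (c.π ≫ p.extension.map φ.dom) (by
    have h := c.isPullback.paste_horiz (p.extension_map_isPullback (a := φ.dom) (b := F.graph)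
      (c := G.graph) (d := Poly.prodMap K φ.cod) φ.graph_isPullback)
    rw [← Poly.strength_naturality] at h
    exact h)

lemma mapHom_dom {F G : Poly K I} (c : FibrewiseExtension p F) (d : FibrewiseExtension p G)
    (φ : CartHom F G) :
    (mapHom c d φ).dom ≫ d.π = c.π ≫ p.extension.map φ.dom :=
  d.homOf_dom _ _ _

variable (P : PolynomialPseudomonad I)

/-- The pullback square formed by the components of `P_η`. -/
def unitHom {F : Poly K I} (c : FibrewiseExtension P.p F) : CartHom F c.obj :=
  c.homOf (P.unit F.cod) (P.unit F.dom) (by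
    rw [P.unit_strength]
    exact P.unit_isPullback F.graph)

lemma unitHom_dom {F : Poly K I} (c : FibrewiseExtension P.p F) :
    (c.unitHom P).dom ≫ c.π = P.unit F.dom :=
  c.homOf_dom _ _ _

/-- The pullback square formed by the components of `P_μ`. -/
def multHom {F : Poly K I} (c : FibrewiseExtension P.p F) (d : FibrewiseExtension P.p c.obj) :
    CartHom d.obj c.obj :=
  c.homOf (P.mult F.cod) (d.π ≫ P.p.extension.map c.π ≫ P.mult F.dom) (by
    have h₁ := P.p.extension_map_isPullback (a := c.π) (b := c.obj.graph)
      (c := P.p.extension.map F.graph) (d := P.p.strengthOver K F.cod) c.isPullback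
    have h := d.isPullback.paste_horiz (h₁.paste_horiz (P.mult_isPullback F.graph))
    have e := P.mult_strength K F.cod
    exact (congrArg (IsPullback _ _ _) e) ▸ h)

lemma multHom_dom {F : Poly K I} (c : FibrewiseExtension P.p F)
    (d : FibrewiseExtension P.p c.obj) :
    (multHom P c d).dom ≫ c.π = d.π ≫ P.p.extension.map c.π ≫ P.mult F.dom :=
  c.homOf_dom _ _ _

/-! ### Equations between the pullback squares -/

lemma mapHom_id (c : FibrewiseExtension p F) : mapHom c c (CartHom.id F) = CartHom.id c.obj := by
  refine c.cartHom_ext (p.extension.map_id F.cod) ?_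
  rw [mapHom_dom]
  refine (congrArg (c.π ≫ ·) (p.extension.map_id F.dom)).trans ?_
  exact (Category.comp_id _).trans (Category.id_comp _).symm

lemma mapHom_comp {F G H : Poly K I} (cF : FibrewiseExtension p F) (cG : FibrewiseExtension p G)
    (cH : FibrewiseExtension p H) (φ : CartHom F G) (ψ : CartHom G H) :
    mapHom cF cH (φ.comp ψ) = (mapHom cF cG φ).comp (mapHom cG cH ψ) := by
  refine cH.cartHom_ext (p.extension.map_comp φ.cod ψ.cod) ?_
  rw [CartHom.comp_dom, Category.assoc, mapHom_dom, mapHom_dom,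
    reassoc_of% (mapHom_dom cF cG φ), CartHom.comp_dom, Functor.map_comp]

variable {P}

lemma unitHom_naturality {F G : Poly K I} (φ : CartHom F G) (cF : FibrewiseExtension P.p F)
    (cG : FibrewiseExtension P.p G) :
    φ.comp (cG.unitHom P) = (cF.unitHom P).comp (mapHom cF cG φ) := by
  refine cG.cartHom_ext (P.unit_naturality φ.cod) ?_
  rw [CartHom.comp_dom, CartHom.comp_dom, Category.assoc, Category.assoc, mapHom_dom, unitHom_dom,
    reassoc_of% (unitHom_dom P cF), P.unit_naturality]

lemma multHom_naturality {F G : Poly K I} (φ : CartHom F G) (cF : FibrewiseExtension P.p F)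
    (cG : FibrewiseExtension P.p G) (dF : FibrewiseExtension P.p cF.obj)
    (dG : FibrewiseExtension P.p cG.obj) :
    (mapHom dF dG (mapHom cF cG φ)).comp (multHom P cG dG) =
      (multHom P cF dF).comp (mapHom cF cG φ) := by
  refine cG.cartHom_ext (P.mult_naturality φ.cod) ?_
  rw [CartHom.comp_dom, CartHom.comp_dom, Category.assoc, Category.assoc, mapHom_dom, multHom_dom,
    reassoc_of% (multHom_dom P cF dF), reassoc_of% (mapHom_dom dF dG (mapHom cF cG φ)),
    ← Functor.map_comp_assoc, mapHom_dom, Functor.map_comp, Category.assoc, P.mult_naturality]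

lemma multHom_assoc (hP : P.IsTwoMonad) {F : Poly K I} (c₁ : FibrewiseExtension P.p F)
    (c₂ : FibrewiseExtension P.p c₁.obj) (c₃ : FibrewiseExtension P.p c₂.obj) :
    (mapHom c₃ c₂ (multHom P c₁ c₂)).comp (multHom P c₁ c₂) =
      (multHom P c₂ c₃).comp (multHom P c₁ c₂) := by
  refine c₁.cartHom_ext (P.mult_assoc hP F.cod) ?_
  have e := congrArg (c₃.π ≫ P.p.extension.map c₂.π ≫ ·)
    (congrArg (· ≫ P.mult F.dom) (P.mult_naturality c₁.π))
  rw [CartHom.comp_dom, CartHom.comp_dom, Category.assoc, Category.assoc, multHom_dom,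
    reassoc_of% (multHom_dom P c₂ c₃), reassoc_of% (mapHom_dom c₃ c₂ (multHom P c₁ c₂)),
    ← Functor.map_comp_assoc, multHom_dom, Functor.map_comp, Functor.map_comp, Category.assoc,
    Category.assoc, P.mult_assoc hP]
  simpa only [Category.assoc] using e

lemma mapHom_unitHom_multHom (hP : P.IsTwoMonad) {F : Poly K I} (c₁ : FibrewiseExtension P.p F)
    (c₂ : FibrewiseExtension P.p c₁.obj) :
    (mapHom c₁ c₂ (c₁.unitHom P)).comp (multHom P c₁ c₂) = CartHom.id c₁.obj := by
  refine c₁.cartHom_ext (P.map_unit_mult hP F.cod) ?_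
  rw [CartHom.comp_dom, Category.assoc, multHom_dom,
    reassoc_of% (mapHom_dom c₁ c₂ (c₁.unitHom P)), ← Functor.map_comp_assoc, unitHom_dom,
    P.map_unit_mult hP]
  exact (Category.comp_id _).trans (Category.id_comp _).symm

lemma unitHom_multHom (hP : P.IsTwoMonad) {F : Poly K I} (c₁ : FibrewiseExtension P.p F)
    (c₂ : FibrewiseExtension P.p c₁.obj) :
    (c₂.unitHom P).comp (multHom P c₁ c₂) = CartHom.id c₁.obj := by
  refine c₁.cartHom_ext (P.unit_mult hP F.cod) ?_
  have e := congrArg (· ≫ P.mult F.dom) (P.unit_naturality c₁.π)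
  simp only [Category.assoc] at e
  rw [CartHom.comp_dom, Category.assoc, multHom_dom, reassoc_of% (unitHom_dom P c₂), ← e,
    P.unit_mult hP]
  exact (Category.comp_id _).trans (Category.id_comp _).symm

end FibrewiseExtension

/-! ### The lifted pseudomonad -/

namespace FibrewiseExtension

lemma dom_rfl {I J K : E} {p : Poly I J} {F : Poly K I} (c : FibrewiseExtension p F) :
    c.dom rfl = c.π :=
  Category.id_comp _

end FibrewiseExtension

namespace PolynomialPseudomonad

variable {I : E} (P : PolynomialPseudomonad I) (c : ∀ F : Poly I I, FibrewiseExtension P.p F)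

/-- The 2-functor which applies `P_p` fibrewise. -/
def liftFunctor : StrictPseudofunctor (Poly I I) (Poly I I) :=
  StrictPseudofunctor.mk''
    { obj := fun F => (c F).obj
      map := fun {F G} φ => FibrewiseExtension.mapHom (c F) (c G) φ
      map₂ := fun _ => adj _ _
      map₂_id := fun _ => Subsingleton.elim _ _
      map₂_comp := fun _ _ => Subsingleton.elim _ _
      map_id := fun F => FibrewiseExtension.mapHom_id (c F)
      map_comp := fun φ ψ => FibrewiseExtension.mapHom_comp _ _ _ φ ψ
      map₂_whisker_left := fun _ _ _ _ => Subsingleton.elim _ _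
      map₂_whisker_right := fun _ _ => Subsingleton.elim _ _ }

/-- The pseudomonad that applies `P` fibrewise. Its 2-cells are the unique adjustments between
parallel cartesian morphisms. -/
def lift : Pseudomonad (Poly I I) where
  T := P.liftFunctor c
  η :=
    { app := fun F => (c F).unitHom P
      naturality := fun _ => adjIso _ _
      naturality_naturality := fun _ => Subsingleton.elim _ _
      naturality_id := fun _ => Subsingleton.elim _ _
      naturality_comp := fun _ _ => Subsingleton.elim _ _ }
  μ :=
    { app := fun F => FibrewiseExtension.multHom P (c F) (c (c F).obj)
      naturality := fun _ => adjIso _ _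
      naturality_naturality := fun _ => Subsingleton.elim _ _
      naturality_id := fun _ => Subsingleton.elim _ _
      naturality_comp := fun _ _ => Subsingleton.elim _ _ }
  α _ := adjIso _ _
  lam _ := adjIso _ _
  rho _ := adjIso _ _
  α_naturality _ := (adj_subsingleton _ _).allEq _ _
  lam_naturality _ := (adj_subsingleton _ _).allEq _ _
  rho_naturality _ := (adj_subsingleton _ _).allEq _ _
  assoc_coherence _ := (adj_subsingleton _ _).allEq _ _
  unit_coherence _ := (adj_subsingleton _ _).allEq _ _

lemma lift_isLift : P.IsLift c (P.lift c) where
  obj_eq _ := rfl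
  map_cod φ := (Category.comp_id _).trans (Category.id_comp _).symm
  map_dom {F G} φ := by
    change CartHom.dom (FibrewiseExtension.mapHom (c F) (c G) φ) ≫ (c G).dom rfl =
      (c F).dom rfl ≫ _
    rw [FibrewiseExtension.dom_rfl, FibrewiseExtension.dom_rfl]
    exact FibrewiseExtension.mapHom_dom _ _ _
  unit_cod F := Category.comp_id _
  unit_dom F := by
    change CartHom.dom ((c F).unitHom P) ≫ (c F).dom rfl = _
    rw [FibrewiseExtension.dom_rfl]
    exact (c F).unitHom_dom P
  mult_cod F := by
    change P.mult F.cod ≫ 𝟙 _ = 𝟙 _ ≫ P.p.extension.map (𝟙 (P.p.extension.obj F.cod)) ≫ P.mult F.cod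
    rw [CategoryTheory.Functor.map_id, Category.comp_id, Category.id_comp, Category.id_comp]
  mult_dom F := by
    change CartHom.dom (FibrewiseExtension.multHom P (c F) (c (c F).obj)) ≫ (c F).dom rfl =
      (c (c F).obj).dom rfl ≫ P.p.extension.map ((c F).dom rfl) ≫ _
    rw [FibrewiseExtension.dom_rfl, FibrewiseExtension.dom_rfl]
    exact FibrewiseExtension.multHom_dom _ _ _

/-- Invertible 2-cells between equal 1-cells are identities, so only equations of 1-cells are
needed. -/
lemma lift_isTwoMonad (hP : P.IsTwoMonad) : (P.lift c).IsTwoMonad := by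
  have ext_iso : ∀ {F G : Poly I I} {φ ψ : F ⟶ G} (σ : φ ≅ ψ), φ = ψ → ∃ e, σ = eqToIso e :=
    fun σ e => ⟨e, Iso.ext (Subsingleton.elim _ _)⟩
  exact
    { α_eq := fun F => ext_iso _ (FibrewiseExtension.multHom_assoc hP (c F) (c _) (c _))
      lam_eq := fun F => ext_iso _ (FibrewiseExtension.mapHom_unitHom_multHom hP (c F) (c _))
      rho_eq := fun F => ext_iso _ (FibrewiseExtension.unitHom_multHom hP (c F) (c _))
      η_naturality := fun {F G} φ => ext_iso _ (FibrewiseExtension.unitHom_naturality φ (c F) (c G))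
      μ_naturality := fun {F G} φ => ext_iso _
        (FibrewiseExtension.multHom_naturality φ (c F) (c G) (c _) (c _)) }

end PolynomialPseudomonad
end
end LCC

theorem mainTheorem3 {E : Type u} [CategoryTheory.Category.{v} E]
    [CategoryTheory.CartesianMonoidalCategory E] [CategoryTheory.ChosenPullbacks E]
    [∀ {X Y : E} (f : X ⟶ Y), CategoryTheory.ExponentiableMorphism f]
    {I : E} (P : LCC.PolynomialPseudomonad I) :
    (∀ c : ∀ F : LCC.Poly I I, LCC.FibrewiseExtension P.p F,
      ∃ T : LCC.Pseudomonad (LCC.Poly I I), P.IsLift c T ∧ (P.IsTwoMonad → T.IsTwoMonad)) ∧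
    (∀ hI : CategoryTheory.Limits.IsTerminal I,
      ∃ T : LCC.Pseudomonad (LCC.Poly I I),
        P.IsLift (LCC.FibrewiseExtension.ofTerminal hI P.p) T ∧
          (P.IsTwoMonad → T.IsTwoMonad)) :=
  ⟨fun c => ⟨P.lift c, P.lift_isLift c, P.lift_isTwoMonad c⟩,
    fun hI => ⟨P.lift (LCC.FibrewiseExtension.ofTerminal hI P.p), P.lift_isLift _,
      P.lift_isTwoMonad _⟩⟩
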